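/- A Steiner triple system of order $v$, STS$(v)$, is a $v$-element set $V$ with a collection of $3$-subsets (blocks) such that any two distinct points lie in exactly one block. A $3$-coloring of it is a map $\varphi\colon V\to C$, $|C|=3$, under which no block is monochromatic; the system is $3$-chromatic if it has a $3$-coloring and cannot be colored with fewer colors, and uniquely $3$-colorable if it is $3$-chromatic and all its $3$-colorings produce the same partition of $V$ into color classes. A set $S\subseteq V$ with an assignment of colors to its points is a defining set if it extends to exactly one $3$-coloring of the system. For a $3$-chromatic STS$(v)$ $D$, the defining number $d(D,3)$ is the least size of a defining set, and $d(v,3)$ is the minimum of $d(D,3)$ over all $3$-chromatic STS$(v)$ $D$. Let $v\ge 25$ with $v\equiv 1$ or $3 \pmod 6$. Then $d(v,3)=2$. More precisely: (i) there is a uniquely $3$-colorable STS$(v)$; (ii) in every uniquely $3$-colorable STS$(v)$ $D$, for every $3$-coloring $\varphi$ any two points $x,y$ with $\varphi(x)\neq\varphi(y)$, with their colors under $\varphi$, form a defining set, and $d(D,3)=2$; (iii) for every STS$(v)$, every $3$-coloring $\varphi$ of it and every point $x$, interchanging in $\varphi$ the two colors different from $\varphi(x)$ gives a $3$-coloring different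 from $\varphi$ with the same color at $x$; hence in no STS$(v)$ is a set of at most one precolored point a defining set. -/

import Mathlib

/-- A Steiner triple system on the point set `V`: a collection of `3`-subsets of `V` (blocks) such
that any two distinct points lie together in exactly one block. -/
structure SteinerTripleSystem (V : Type*) where
  /-- the blocks (triples) -/
  blocks : Finset (Finset V)
  card_block : ∀ B ∈ blocks, B.card = 3
  existsUnique_block : ∀ x y : V, x ≠ y → ∃! B : Finset V, B ∈ blocks ∧ x ∈ B ∧ y ∈ B

namespace SteinerTripleSystem

/-- `φ` is a (weak) coloring of `D`: no block is monochromatic. -/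
def IsColoring {V C : Type*} (D : SteinerTripleSystem V) (φ : V → C) : Prop :=
  ∀ B ∈ D.blocks, ∃ x ∈ B, ∃ y ∈ B, φ x ≠ φ y

/-- `D` is `m`-chromatic: `m` is the least number of colors with which `D` can be colored. -/
def IsChromatic {V : Type*} (D : SteinerTripleSystem V) (m : ℕ) : Prop :=
  IsLeast {k : ℕ | ∃ φ : V → Fin k, D.IsColoring φ} m

/-- `D` is uniquely `m`-colorable: it is `m`-chromatic and all its `m`-colorings produce the same
partition of the points into color classes. -/
def IsUniquelyColorable {V : Type*} (D : SteinerTripleSystem V) (m : ℕ) : Prop :=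
  D.IsChromatic m ∧
    ∀ φ ψ : V → Fin m, D.IsColoring φ → D.IsColoring ψ → Setoid.ker φ = Setoid.ker ψ

/-- The set `S` of points with the assignment `c` of colors to them is a defining set: exactly one
`m`-coloring of `D` extends `c`. -/
def IsDefiningSet {V : Type*} (D : SteinerTripleSystem V) (m : ℕ) (S : Finset V)
    (c : S → Fin m) : Prop :=
  ∃! φ : V → Fin m, D.IsColoring φ ∧ ∀ x : S, φ x = c x

/-- `n` is the defining number of `D` (for `m` colors): the size of a smallest defining set. -/
def IsDefiningNumber {V : Type*} (D : SteinerTripleSystem V) (m n : ℕ) : Prop :=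
  IsLeast {k : ℕ | ∃ (S : Finset V) (c : S → Fin m), D.IsDefiningSet m S c ∧ S.card = k} n

/-- The set of the defining numbers of all `m`-chromatic Steiner triple systems of order `v`;
its minimum is the number `d(v, m)`. -/
def definingNumbers (v m : ℕ) : Set ℕ :=
  {n : ℕ | ∃ D : SteinerTripleSystem (Fin v), D.IsChromatic m ∧ D.IsDefiningNumber m n}

end SteinerTripleSystem

/-! The lower bound is a symmetry. Interchanging the two colors not used at `x` turns colorings into
colorings, keeps the color of `x`, and changes something, because a coloring uses at least two
colors. So one precolored point never suffices. Conversely, if the color classes are forced, naming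
the colors of two of them names the third as well. What remains is the existence of a uniquely
3-colorable system of every admissible order `v ≥ 25`.

Write `v = 6 n + w` with `w = 1` or `w = 3`. The points are `w` fixed points, forming a subsystem,
and `n` groups of six, two points of each color. A `System` is a Steiner triple system on these
points, as a quasigroup, for which this standard coloring is proper; it is `Rigid` if every proper
3-coloring is the standard one up to a permutation of the colors. Rigid systems are uniquely
3-colorable (`System.Rigid.isUniquelyColorable`).

The recursion (`existsRigid_of_ring`) passes from `m` to `3 m + t` with `t ≤ m`. A transversal
design with four groups of size `m`, whose lines come from a ring with units `u` and `u - 1`, is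
truncated to `t` points in its last group. Each point is replaced by six, each line by a small
colored design, and each group, together with the fixed points, is filled with a colored system. If
the three full groups carry rigid systems, the result is rigid (`rigid_fill`): a coloring is a
permuted standard coloring on each full group; the common fixed points and the blocks across these
groups make the three permutations equal; and blocks through a point of the truncated group exclude
all colors but one. The truncated group therefore needs only a colored system, not a rigid one.

The base cases `4 ≤ n < 12` are explicit tables. Their rigidity is certified by an exhaustive
backtracking search, which is proved sound (`search_sound`) and evaluated by the kernel. -/

/-! ### A verified backtracking search for `3`-colorings

The triples are given by a bit table `tbl`: the bit `(p * v + q) * v + r` says that `{p, q, r}` is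
a block. The functions below are written with recursors and with the primitive operations on
natural numbers, so that the kernel evaluates them quickly. -/

namespace TripleTable

noncomputable section

/-- `f n`, where `n` is evaluated first. -/
def force {α : Type} (f : ℕ → α) (n : ℕ) : α :=
  Nat.rec (f Nat.zero) (fun k _ => f (Nat.succ k)) n

theorem force_eq {α : Type} (f : ℕ → α) (n : ℕ) : force f n = f n := by
  cases n <;> rfl

/-- `r` if `x = 0`, and `true` otherwise. -/
def ifZero (r : Bool) (x : ℕ) : Bool :=
  Nat.rec r (fun _ _ => true) x

theorem of_ifZero {r : Bool} {x : ℕ} (h : ifZero r x = true) (hx : x = 0) : r = true := by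
  subst hx; exact h

/-- The continuation of the search: it takes the set of unassigned points, for each color the set
of points that cannot have it, and for each color the list of the points `q` that have it, each
stored as `q * v`. -/
abbrev Cont := ℕ → ℕ → ℕ → ℕ → List ℕ → List ℕ → List ℕ → Bool

section
variable (full v rm tbl t0 t1 t2 : ℕ)

/-- Add to `e` the third points of the blocks through `p` (with table row `row`) and a point
of the list `l`. -/
def excl (row e : ℕ) (l : List ℕ) : ℕ :=
  Nat.lor e (Nat.land full (List.rec Nat.zero (fun q _ r => Nat.lor (Nat.shiftRight row q) r) l))

/-- In the three variants, `e` is the enlarged set of exclusions for the color given to the point,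
while the bit `b` of the point joins the exclusions for the other two colors. -/
def assign0 (k : Cont) (un e1 e2 : ℕ) (a0 a1 a2 : List ℕ) (b pv e : ℕ) : Bool :=
  k un e (Nat.lor e1 b) (Nat.lor e2 b) (pv :: a0) a1 a2

def assign1 (k : Cont) (un e0 e2 : ℕ) (a0 a1 a2 : List ℕ) (b pv e : ℕ) : Bool :=
  k un (Nat.lor e0 b) e (Nat.lor e2 b) a0 (pv :: a1) a2

def assign2 (k : Cont) (un e0 e1 : ℕ) (a0 a1 a2 : List ℕ) (b pv e : ℕ) : Bool :=
  k un (Nat.lor e0 b) (Nat.lor e1 b) e a0 a1 (pv :: a2)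

/-- Try the possible colors of a point. -/
def branch (k : Cont) (e0 e1 e2 : ℕ) (a0 a1 a2 : List ℕ) (un b pv row : ℕ) : Bool :=
  and (ifZero (force (assign0 k un e1 e2 a0 a1 a2 b pv) (excl full row e0 a0)) (Nat.land e0 b))
    (and
      (ifZero (force (assign1 k un e0 e2 a0 a1 a2 b pv) (excl full row e1 a1)) (Nat.land e1 b))
      (ifZero (force (assign2 k un e0 e1 a0 a1 a2 b pv) (excl full row e2 a2)) (Nat.land e2 b)))

def branchAt (k : Cont) (un e0 e1 e2 : ℕ) (a0 a1 a2 : List ℕ) (p b : ℕ) : Bool :=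
  force (fun un' => force (fun pv => force (branch full k e0 e1 e2 a0 a1 a2 un' b pv)
    (Nat.land rm (Nat.shiftRight tbl (Nat.mul pv v)))) (Nat.mul p v)) (Nat.xor un b)

def pick (k : Cont) (un e0 e1 e2 : ℕ) (a0 a1 a2 : List ℕ) (p : ℕ) : Bool :=
  force (branchAt full v rm tbl k un e0 e1 e2 a0 a1 a2 p) (Nat.shiftLeft (nat_lit 1) p)

/-- The next point: one of the points in `s` (with one possible color) if there are any, else one
with two possible colors if there are any, else any unassigned one. -/
def choose (un e0 e1 e2 s : ℕ) : ℕ :=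
  Nat.rec
    ((fun s' => Nat.rec (Nat.log2 un) (fun _ _ => Nat.log2 s') s')
      (Nat.land un (Nat.lor (Nat.lor e0 e1) e2)))
    (fun _ _ => Nat.log2 s) s

def node (k : Cont) (un e0 e1 e2 : ℕ) (a0 a1 a2 : List ℕ) : Bool :=
  Nat.rec (and (Nat.beq e0 t0) (and (Nat.beq e1 t1) (Nat.beq e2 t2)))
    (fun _ _ => force (pick full v rm tbl k un e0 e1 e2 a0 a1 a2)
      (choose un e0 e1 e2
        (Nat.land un (Nat.lor (Nat.land e0 e1) (Nat.land e2 (Nat.lor e0 e1)))))) un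

/-- Search all colorings; succeed if each of them ends with the sets `t0`, `t1`, `t2` of points
that do not have the respective color. -/
def search (fuel : ℕ) : Cont :=
  Nat.rec (fun _ _ _ _ _ _ _ => false)
    (fun _ k un e0 e1 e2 a0 a1 a2 => ifZero (node full v rm tbl t0 t1 t2 k un e0 e1 e2 a0 a1 a2)
      (Nat.land (Nat.land e0 e1) e2)) fuel

end

variable {full v rm tbl t0 t1 t2 : ℕ} {ψ : ℕ → Fin 3}

/-- The points of the list `l` of multiples of `v` have color `c`. -/
def Assigned (v : ℕ) (ψ : ℕ → Fin 3) (c : Fin 3) (l : List ℕ) : Prop :=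
  ∀ x ∈ l, ∃ q < v, x = q * v ∧ ψ q = c

/-- The elements of the set `e` are points that do not have color `c`. -/
def Excluded (v : ℕ) (ψ : ℕ → Fin 3) (c : Fin 3) (e : ℕ) : Prop :=
  ∀ i, e.testBit i = true → i < v ∧ ψ i ≠ c

/-- No block of the table is monochromatic. -/
def ProperOn (tbl v : ℕ) (ψ : ℕ → Fin 3) : Prop :=
  ∀ p < v, ∀ q < v, ∀ r < v, tbl.testBit ((p * v + q) * v + r) = true →
    ¬ (ψ p = ψ q ∧ ψ r = ψ p)

theorem Assigned.cons {c : Fin 3} {l : List ℕ} (h : Assigned v ψ c l) {p : ℕ} (hp : p < v)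
    (hc : ψ p = c) : Assigned v ψ c (p * v :: l) := by
  intro x hx
  rcases List.mem_cons.1 hx with rfl | hx
  · exact ⟨p, hp, rfl, hc⟩
  · exact h x hx

theorem Excluded.lor_bit {c : Fin 3} {e : ℕ} (h : Excluded v ψ c e) {p : ℕ} (hp : p < v)
    (hc : ψ p ≠ c) : Excluded v ψ c (e ||| 1 <<< p) := by
  intro i hb
  rw [Nat.testBit_or, Bool.or_eq_true] at hb
  rcases hb with hb | hb
  · exact h i hb
  · rw [Nat.one_shiftLeft, Nat.testBit_two_pow, decide_eq_true_eq] at hb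
    exact hb ▸ ⟨hp, hc⟩

theorem testBit_listLor {row i : ℕ} {l : List ℕ}
    (h : (List.rec Nat.zero (fun q _ r => Nat.lor (Nat.shiftRight row q) r) l : ℕ).testBit i
      = true) : ∃ x ∈ l, row.testBit (x + i) = true := by
  induction l with
  | nil => exact absurd h (by simp)
  | cons q l ih =>
    change ((row >>> q) ||| _).testBit i = true at h
    rw [Nat.testBit_or, Bool.or_eq_true, Nat.testBit_shiftRight] at h
    rcases h with h | h
    · exact ⟨q, by simp, h⟩
    · obtain ⟨x, hx, hx'⟩ := ih h
      exact ⟨x, by simp [hx], hx'⟩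

/-- If `p` and `q` have color `c`, the third point of their block cannot have it. In row `p`, the
entry for `q` starts at bit `q * v`, which is why the assigned points are stored as these multiples;
`full` cuts off the later entries. -/
theorem Excluded.excl {c : Fin 3} {e p : ℕ} {l : List ℕ} (hψ : ProperOn tbl v ψ)
    (hfull : ∀ i, full.testBit i = true → i < v) (h : Excluded v ψ c e) (hl : Assigned v ψ c l) (hp : p < v) (hc : ψ p = c) :
    Excluded v ψ c (excl full (rm &&& tbl >>> (p * v * v)) e l) := by
  intro i hb
  change (e ||| full &&& _).testBit i = true at hb
  rw [Nat.testBit_or, Bool.or_eq_true] at hb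
  rcases hb with hb | hb
  · exact h i hb
  · rw [Nat.testBit_and, Bool.and_eq_true] at hb
    have hi := hfull i hb.1
    obtain ⟨x, hx, hx'⟩ := testBit_listLor hb.2
    obtain ⟨q, hq, rfl, hqc⟩ := hl x hx
    rw [Nat.testBit_and, Bool.and_eq_true, Nat.testBit_shiftRight] at hx'
    have e1 : p * v * v + (q * v + i) = (p * v + q) * v + i := by ring
    rw [e1] at hx'
    refine ⟨hi, fun hic => ?_⟩
    exact hψ p hp q hq i hi hx'.2 ⟨hc.trans hqc.symm, hic.trans hc.symm⟩

theorem testBit_log2 {n : ℕ} (h : n ≠ 0) : n.testBit n.log2 = true := by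
  rw [Nat.testBit_log2]
  exact h

/-- Soundness needs only that the chosen point is unassigned. The preference for constrained points
affects the size of the search tree alone, so `x` is arbitrary. -/
theorem testBit_choose {un e0 e1 e2 x : ℕ} (h : un ≠ 0) :
    un.testBit (choose un e0 e1 e2 (un &&& x)) = true := by
  unfold choose
  have key : ∀ y : ℕ, (un &&& y) ≠ 0 → un.testBit (un &&& y).log2 = true := by
    intro y hy
    have := testBit_log2 hy
    rw [Nat.testBit_and, Bool.and_eq_true] at this
    exact this.1
  rcases h1 : un &&& x with _ | m
  · change un.testBit ((fun s' => Nat.rec (Nat.log2 un) (fun _ _ => Nat.log2 s') s')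
      (un &&& ((e0 ||| e1) ||| e2))) = true
    have h2 := key ((e0 ||| e1) ||| e2)
    generalize un &&& ((e0 ||| e1) ||| e2) = s at h2
    rcases s with _ | m
    · exact testBit_log2 h
    · exact h2 (Nat.succ_ne_zero m)
  · have := key x (by simp [h1])
    rwa [h1] at this

/-- A given proper coloring `ψ` follows one path of the search tree, along which all exclusions are
true of `ψ`. This path is never cut off, so it ends at a leaf, where the exclusions were compared
with the targets `t0`, `t1`, `t2`. -/
theorem search_sound (hψ : ProperOn tbl v ψ) (hfull : ∀ i, full.testBit i = true → i < v)
    (fuel : ℕ) :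
    ∀ (un e0 e1 e2 : ℕ) (a0 a1 a2 : List ℕ), (∀ i, un.testBit i = true → i < v) →
      Excluded v ψ 0 e0 → Excluded v ψ 1 e1 → Excluded v ψ 2 e2 →
      Assigned v ψ 0 a0 → Assigned v ψ 1 a1 → Assigned v ψ 2 a2 →
      search full v rm tbl t0 t1 t2 fuel un e0 e1 e2 a0 a1 a2 = true →
      Excluded v ψ 0 t0 ∧ Excluded v ψ 1 t1 ∧ Excluded v ψ 2 t2 := by
  induction fuel with
  | zero => intro _ _ _ _ _ _ _ _ _ _ _ _ _ _ h; exact absurd h (by simp [search])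
  | succ n ih =>
    intro un e0 e1 e2 a0 a1 a2 hun h0 h1 h2 g0 g1 g2 h
    have fin3 : ∀ c : Fin 3, c = 0 ∨ c = 1 ∨ c = 2 := by decide
    -- A point excluded from all three colors would have no color under `ψ`, so the node is not a
    -- dead end.
    have hdead : e0 &&& e1 &&& e2 = 0 := by
      by_contra hne
      have hb := testBit_log2 hne
      simp only [Nat.testBit_and, Bool.and_eq_true] at hb
      rcases fin3 (ψ (e0 &&& e1 &&& e2).log2) with hc | hc | hc
      · exact (h0 _ hb.1.1).2 hc
      · exact (h1 _ hb.1.2).2 hc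
      · exact (h2 _ hb.2).2 hc
    replace h : node full v rm tbl t0 t1 t2 (search full v rm tbl t0 t1 t2 n)
      un e0 e1 e2 a0 a1 a2 = true := of_ifZero h hdead
    by_cases hu : un = 0
    · subst hu
      change (Nat.beq e0 t0 && (Nat.beq e1 t1 && Nat.beq e2 t2)) = true at h
      simp only [Bool.and_eq_true, Nat.beq_eq] at h
      obtain ⟨rfl, rfl, rfl⟩ := h
      exact ⟨h0, h1, h2⟩
    · have hnode : force (pick full v rm tbl (search full v rm tbl t0 t1 t2 n) un e0 e1 e2 a0 a1 a2)
          (choose un e0 e1 e2 (un &&& ((e0 &&& e1) ||| (e2 &&& (e0 ||| e1))))) = true := by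
        obtain ⟨m, rfl⟩ := Nat.exists_eq_succ_of_ne_zero hu
        exact h
      rw [force_eq] at hnode
      have hp := testBit_choose (e0 := e0) (e1 := e1) (e2 := e2)
        (x := (e0 &&& e1) ||| (e2 &&& (e0 ||| e1))) hu
      generalize choose un e0 e1 e2 _ = p at hnode hp
      have hpv := hun p hp
      unfold pick branchAt at hnode
      simp only [force_eq] at hnode
      have hun' : ∀ i, (Nat.xor un (1 <<< p)).testBit i = true → i < v := by
        intro i hi
        change (un ^^^ (1 <<< p)).testBit i = true at hi
        by_cases hip : i = p
        · exact hip ▸ hpv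
        · rw [Nat.testBit_xor, Nat.one_shiftLeft, Nat.testBit_two_pow,
            decide_eq_false (Ne.symm hip)] at hi
          exact hun i (by simpa using hi)
      change (ifZero _ (e0 &&& (1 <<< p)) && (ifZero _ (e1 &&& (1 <<< p)) &&
        ifZero _ (e2 &&& (1 <<< p)))) = true at hnode
      simp only [Bool.and_eq_true] at hnode
      obtain ⟨k0, k1, k2⟩ := hnode
      -- The color that `ψ` gives to `p` is not excluded at `p`, so the branch for this color was
      -- really searched.
      have clear : ∀ {c e}, Excluded v ψ c e → ψ p = c → e &&& 1 <<< p = 0 := by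
        intro c e he hc
        by_contra hne
        have hb := testBit_log2 hne
        rw [Nat.testBit_and, Bool.and_eq_true, Nat.one_shiftLeft, Nat.testBit_two_pow,
          decide_eq_true_eq] at hb
        exact (he _ hb.1).2 (by rw [← hb.2]; exact hc)
      rcases fin3 (ψ p) with hc | hc | hc
      · replace k0 := of_ifZero k0 (clear h0 hc)
        rw [force_eq] at k0
        exact ih _ _ _ _ _ _ _ hun' (h0.excl hψ hfull g0 hpv hc)
          (h1.lor_bit hpv (by rw [hc]; decide)) (h2.lor_bit hpv (by rw [hc]; decide))
          (g0.cons hpv hc) g1 g2 k0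
      · replace k1 := of_ifZero k1 (clear h1 hc)
        rw [force_eq] at k1
        exact ih _ _ _ _ _ _ _ hun' (h0.lor_bit hpv (by rw [hc]; decide))
          (h1.excl hψ hfull g1 hpv hc) (h2.lor_bit hpv (by rw [hc]; decide))
          g0 (g1.cons hpv hc) g2 k1
      · replace k2 := of_ifZero k2 (clear h2 hc)
        rw [force_eq] at k2
        exact ih _ _ _ _ _ _ _ hun' (h0.lor_bit hpv (by rw [hc]; decide))
          (h1.lor_bit hpv (by rw [hc]; decide)) (h2.excl hψ hfull g2 hpv hc)
          g0 g1 (g2.cons hpv hc) k2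

end

end TripleTable

namespace TripleTable

noncomputable section

/-! ### Tables of Steiner triple systems -/

/-- The set of the elements of a list. -/
def bits (l : List ℕ) : ℕ :=
  l.foldr (fun p r => Nat.lor (Nat.shiftLeft 1 p) r) 0

theorem testBit_bits {l : List ℕ} {i : ℕ} : (bits l).testBit i = true ↔ i ∈ l := by
  induction l with
  | nil => simp [bits]
  | cons a l ih =>
    change ((1 <<< a) ||| bits l).testBit i = true ↔ _
    rw [Nat.testBit_or, Bool.or_eq_true, ih, Nat.one_shiftLeft, Nat.testBit_two_pow,
      decide_eq_true_eq, List.mem_cons, eq_comm]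

/-- The set of all points. -/
def full (v : ℕ) : ℕ := 2 ^ v - 1

theorem testBit_full {v i : ℕ} : (full v).testBit i = true ↔ i < v := by
  simp [full, Nat.testBit_two_pow_sub_one]

/-- The entry for the pair `p`, `q` in a table of triples: the set of the third points. -/
def entry (tbl v p q : ℕ) : ℕ :=
  Nat.land (full v) (Nat.shiftRight tbl (Nat.mul (Nat.add (Nat.mul p v) q) v))

theorem testBit_entry {tbl v p q r : ℕ} :
    (entry tbl v p q).testBit r = true ↔ r < v ∧ tbl.testBit ((p * v + q) * v + r) = true := by
  change (full v &&& tbl >>> ((p * v + q) * v)).testBit r = true ↔ _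
  rw [Nat.testBit_and, Bool.and_eq_true, testBit_full, Nat.testBit_shiftRight]

/-- The third point of the block through `p` and `q`. -/
def third (tbl v p q : ℕ) : ℕ := Nat.log2 (entry tbl v p q)

/-- The color of the point `p`: the points from `s` on get the colors `0, 1, 2, 0, 1, 2, …`. -/
def color (s p : ℕ) : ℕ := Nat.mod (Nat.sub p s) 3

theorem color_lt (s p : ℕ) : color s p < 3 := Nat.mod_lt _ (by decide)

/-- The table describes a Steiner triple system, properly colored by `color s`. -/
structure Valid (tbl v s : ℕ) : Prop where
  entry_self : ∀ p < v, entry tbl v p p = 0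
  entry_eq : ∀ p < v, ∀ q < v, p ≠ q → entry tbl v p q = 1 <<< third tbl v p q
  lt : ∀ p < v, ∀ q < v, p ≠ q → third tbl v p q < v
  ne_left : ∀ p < v, ∀ q < v, p ≠ q → third tbl v p q ≠ p
  comm : ∀ p < v, ∀ q < v, p ≠ q → third tbl v q p = third tbl v p q
  inv : ∀ p < v, ∀ q < v, p ≠ q → third tbl v p (third tbl v p q) = q
  proper : ∀ p < v, ∀ q < v, p ≠ q → color s p = color s q →
    color s (third tbl v p q) ≠ color s p

/-- All numbers below `n` satisfy `f`. -/
def allBelow (f : ℕ → Bool) (n : ℕ) : Bool :=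
  Nat.rec true (fun k r => and (f k) r) n

theorem of_allBelow {f : ℕ → Bool} {n : ℕ} (h : allBelow f n = true) : ∀ k < n, f k = true := by
  induction n with
  | zero => intro k hk; omega
  | succ n ih =>
    have h' : (f n && allBelow f n) = true := h
    rw [Bool.and_eq_true] at h'
    intro k hk
    rcases Nat.lt_succ_iff_lt_or_eq.1 hk with hk | rfl
    · exact ih h'.2 k hk
    · exact h'.1

/-- The entries for the pairs with first point `p`, as a table. -/
def tableRow (tbl v p : ℕ) : ℕ :=
  Nat.land (full (Nat.mul v v)) (Nat.shiftRight tbl (Nat.mul (Nat.mul p v) v))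

/-- A row occupies `v * v` bits; once it is cut out, all checks for first point `p` can read from
this shorter number. -/
theorem entry_tableRow {tbl v p q : ℕ} (hq : q < v) :
    entry (tableRow tbl v p) v 0 q = entry tbl v p q := by
  refine Nat.eq_of_testBit_eq fun r => ?_
  rw [Bool.eq_iff_iff, testBit_entry, testBit_entry]
  refine and_congr_right fun hr => ?_
  change (full (v * v) &&& tbl >>> (p * v * v)).testBit ((0 * v + q) * v + r) = true ↔ _
  have h : (0 * v + q) * v + r < v * v := by nlinarith
  rw [Nat.testBit_and, Bool.and_eq_true, testBit_full, Nat.testBit_shiftRight,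
    show p * v * v + ((0 * v + q) * v + r) = (p * v + q) * v + r by ring]
  exact and_iff_right h

theorem third_tableRow {tbl v p q : ℕ} (hq : q < v) :
    third (tableRow tbl v p) v 0 q = third tbl v p q := by
  rw [third, third, entry_tableRow hq]

/-- The checks for the pair `p`, `q` with entry `e` and third point `t`. -/
def checkEntry (tbl v s p row q e t : ℕ) : Bool :=
  Nat.beq e (Nat.shiftLeft 1 t) && (Nat.blt t v && (!(Nat.beq t p) &&
    ((Nat.ble p q || Nat.beq (third tbl v q p) t) && (Nat.beq (third row v 0 t) q &&
      !(Nat.beq (color s p) (color s q) && Nat.beq (color s t) (color s p))))))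

/-- The checks for the pair `p`, `q`. -/
def checkPair (tbl v s p row q : ℕ) : Bool :=
  force (fun e => bif Nat.beq p q then Nat.beq e 0
    else force (checkEntry tbl v s p row q e) (Nat.log2 e)) (entry row v 0 q)

def checkValid (tbl v s : ℕ) : Bool :=
  allBelow (fun p => force (fun row => allBelow (checkPair tbl v s p row) v) (tableRow tbl v p)) v

theorem Valid.of_check {tbl v s : ℕ} (h : checkValid tbl v s = true) : Valid tbl v s := by
  have key : ∀ p < v, ∀ q < v, checkPair tbl v s p (tableRow tbl v p) q = true := by
    intro p hp q hq
    have := of_allBelow h p hp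
    rw [force_eq] at this
    exact of_allBelow this q hq
  have h0 : ∀ p < v, entry tbl v p p = 0 := by
    intro p hp
    have := key p hp p hp
    rw [checkPair, force_eq, entry_tableRow hp] at this
    simpa using this
  have h1 : ∀ p < v, ∀ q < v, p ≠ q →
      checkEntry tbl v s p (tableRow tbl v p) q (entry tbl v p q) (third tbl v p q) = true := by
    intro p hp q hq hpq
    have := key p hp q hq
    rw [checkPair, force_eq, force_eq, entry_tableRow hq] at this
    have hb : Nat.beq p q = false := by
      rw [← Bool.not_eq_true, Nat.beq_eq]; exact hpq
    rwa [hb] at this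
  simp only [checkEntry, Bool.and_eq_true, Bool.or_eq_true, Bool.not_eq_true', Nat.blt_eq,
    Nat.ble_eq, ← Bool.not_eq_true, Nat.beq_eq] at h1
  -- Commutativity is checked only for `q < p`; the other order follows by symmetry.
  have hcomm : ∀ p < v, ∀ q < p, third tbl v q p = third tbl v p q := fun p hp q hqp =>
    (h1 p hp q (hqp.trans hp) hqp.ne').2.2.2.1.resolve_left (by omega)
  exact
    { entry_self := h0
      entry_eq := fun p hp q hq hpq => (h1 p hp q hq hpq).1
      lt := fun p hp q hq hpq => (h1 p hp q hq hpq).2.1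
      ne_left := fun p hp q hq hpq => (h1 p hp q hq hpq).2.2.1
      comm := fun p hp q hq hpq => by
        rcases Nat.lt_or_gt_of_ne hpq with hlt | hlt
        · exact (hcomm q hq p hlt).symm
        · exact hcomm p hp q hlt
      inv := fun p hp q hq hpq => by
        have := (h1 p hp q hq hpq).2.2.2.2.1
        rwa [third_tableRow (h1 p hp q hq hpq).2.1] at this
      proper := fun p hp q hq hpq hc ht => (h1 p hp q hq hpq).2.2.2.2.2 ⟨hc, ht⟩ }

theorem Valid.testBit_iff {tbl v s : ℕ} (h : Valid tbl v s) {p q r : ℕ} (hp : p < v) (hq : q < v)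
    (hr : r < v) : tbl.testBit ((p * v + q) * v + r) = true ↔ p ≠ q ∧ r = third tbl v p q := by
  have e := @testBit_entry tbl v p q r
  simp only [hr, true_and] at e
  rw [← e]
  by_cases hpq : p = q
  · subst hpq; simp [h.entry_self p hp]
  · rw [h.entry_eq p hp q hq hpq, Nat.one_shiftLeft, Nat.testBit_two_pow, decide_eq_true_eq]
    simp [hpq, eq_comm]

theorem Valid.properOn_iff {tbl v s : ℕ} (h : Valid tbl v s) {ψ : ℕ → Fin 3} :
    ProperOn tbl v ψ ↔ ∀ p < v, ∀ q < v, p ≠ q → ψ p = ψ q → ψ (third tbl v p q) ≠ ψ p := by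
  constructor
  · intro hψ p hp q hq hpq hc ht
    have hr := h.lt p hp q hq hpq
    exact hψ p hp q hq _ hr ((h.testBit_iff hp hq hr).2 ⟨hpq, rfl⟩) ⟨hc, ht⟩
  · intro hψ p hp q hq r hr hb ⟨hc, ht⟩
    obtain ⟨hpq, rfl⟩ := (h.testBit_iff hp hq hr).1 hb
    exact hψ p hp q hq hpq hc ht

/-- All proper `3`-colorings of the table arise from `color s` by a permutation of the colors. -/
def Rigid (tbl v s : ℕ) : Prop :=
  ∀ ψ : ℕ → Fin 3, ProperOn tbl v ψ →
    ∃ σ : Equiv.Perm (Fin 3), ∀ p < v, ψ p = σ (Fin.ofNat 3 (color s p))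

/-- The points below `v` that do not have color `c`. -/
def offColor (v s c : ℕ) : ℕ :=
  bits ((List.range v).filter fun p => !(Nat.beq (color s p) c))

/-- The search, starting from lists of points of colors `0`, `1`, `2`. -/
def searchFrom (tbl v s : ℕ) (k0 k1 k2 : List ℕ) : Bool :=
  force (fun full => force (fun rm => force (fun t0 => force (fun t1 => force (fun t2 =>
    force (fun un => force (fun e0 => force (fun e1 => force (fun e2 =>
      search full v rm tbl t0 t1 t2 v un e0 e1 e2
        (k0.map (Nat.mul v)) (k1.map (Nat.mul v)) (k2.map (Nat.mul v)))
      (bits (k0 ++ k1))) (bits (k0 ++ k2))) (bits (k1 ++ k2)))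
      (Nat.land full (Nat.xor full (bits (k0 ++ (k1 ++ k2))))))
      (offColor v s 2)) (offColor v s 1)) (offColor v s 0)) (2 ^ (v * v) - 1)) (full v)

/-- The targets of the search are the complements of the standard color classes. Once they are valid
exclusions for `ψ`, the color `ψ p` can only be the standard one. -/
theorem eq_color_of_searchFrom {tbl v s : ℕ} {k0 k1 k2 : List ℕ} {ψ : ℕ → Fin 3}
    (hψ : ProperOn tbl v ψ) (h : searchFrom tbl v s k0 k1 k2 = true)
    (h0 : ∀ p ∈ k0, p < v ∧ ψ p = 0) (h1 : ∀ p ∈ k1, p < v ∧ ψ p = 1)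
    (h2 : ∀ p ∈ k2, p < v ∧ ψ p = 2) : ∀ p < v, ψ p = Fin.ofNat 3 (color s p) := by
  unfold searchFrom at h
  simp only [force_eq] at h
  have ex : ∀ (c : Fin 3) (l l' : List ℕ), (∀ p ∈ l, p < v ∧ ψ p ≠ c) →
      (∀ p ∈ l', p < v ∧ ψ p ≠ c) → Excluded v ψ c (bits (l ++ l')) := by
    intro c l l' hl hl' i hi
    rw [testBit_bits, List.mem_append] at hi
    exact hi.elim (hl i) (hl' i)
  have as : ∀ (c : Fin 3) (l : List ℕ), (∀ p ∈ l, p < v ∧ ψ p = c) →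
      Assigned v ψ c (l.map (Nat.mul v)) := by
    intro c l hl x hx
    obtain ⟨q, hq, rfl⟩ := List.mem_map.1 hx
    exact ⟨q, (hl q hq).1, Nat.mul_comm v q, (hl q hq).2⟩
  have ne : ∀ {c c' : Fin 3} {l : List ℕ}, c ≠ c' → (∀ p ∈ l, p < v ∧ ψ p = c) →
      ∀ p ∈ l, p < v ∧ ψ p ≠ c' := fun hc hl p hp => ⟨(hl p hp).1, by rw [(hl p hp).2]; exact hc⟩
  obtain ⟨r0, r1, r2⟩ := search_sound hψ (fun i => testBit_full.1) v _ _ _ _ _ _ _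
    (fun i hi => by
      change (full v &&& _).testBit i = true at hi
      rw [Nat.testBit_and, Bool.and_eq_true] at hi
      exact testBit_full.1 hi.1)
    (ex 0 _ _ (ne (by decide) h1) (ne (by decide) h2))
    (ex 1 _ _ (ne (by decide) h0) (ne (by decide) h2))
    (ex 2 _ _ (ne (by decide) h0) (ne (by decide) h1)) (as 0 _ h0) (as 1 _ h1) (as 2 _ h2) h
  intro p hp
  have off : ∀ c : Fin 3, Excluded v ψ c (offColor v s c) → ψ p = c →
      c = Fin.ofNat 3 (color s p) := by
    intro c hc hpc
    by_contra hne
    refine (hc p (testBit_bits.2 ?_)).2 hpc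
    rw [List.mem_filter, List.mem_range, Bool.not_eq_true', ← Bool.not_eq_true, Nat.beq_eq]
    refine ⟨hp, fun he => hne ?_⟩
    ext
    simp [he]
  have fin3 : ∀ c : Fin 3, c = 0 ∨ c = 1 ∨ c = 2 := by decide
  rcases fin3 (ψ p) with hc | hc | hc
  · exact hc.trans (off 0 r0 hc)
  · exact hc.trans (off 1 r1 hc)
  · exact hc.trans (off 2 r2 hc)

theorem ProperOn.comp {tbl v : ℕ} {ψ : ℕ → Fin 3} (h : ProperOn tbl v ψ)
    (σ : Equiv.Perm (Fin 3)) : ProperOn tbl v (σ ∘ ψ) := fun p hp q hq r hr hb hc =>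
  h p hp q hq r hr hb ⟨σ.injective hc.1, σ.injective hc.2⟩

theorem exists_perm_apply {a b c d : Fin 3} (h : a ≠ b) (h' : c ≠ d) :
    ∃ σ : Equiv.Perm (Fin 3), σ a = c ∧ σ b = d := by
  revert a b c d; decide

/-- Rigidity, by a search that starts from the colors of the points `x` and `y`. -/
def checkRigid (tbl v s x y : ℕ) : Bool :=
  Nat.blt x v && (Nat.blt y v && (!(Nat.beq x y) &&
    (searchFrom tbl v s [x] [y] [] &&
      force (fun z => searchFrom tbl v s [x, y] [z] []) (third tbl v x y))))

/-- Up to a permutation of the colors there are two cases. If `x` and `y` differ, they have colors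
`0` and `1`. If they agree, the third point of their block differs from them, and the colors are
`0`, `0`, `1`. When the standard colors of `x` and `y` differ, the second search can succeed only by
refuting every branch. -/
theorem Valid.rigid_of_check {tbl v s x y : ℕ} (hv : Valid tbl v s)
    (h : checkRigid tbl v s x y = true) : Rigid tbl v s := by
  intro ψ hψ
  rw [checkRigid, force_eq] at h
  simp only [Bool.and_eq_true, Bool.not_eq_true', ← Bool.not_eq_true, Nat.beq_eq,
    Nat.blt_eq] at h
  obtain ⟨hx, hy, hxy, h1, h2⟩ := h
  have fin : ∀ σ : Equiv.Perm (Fin 3), (∀ p < v, (σ ∘ ψ) p = Fin.ofNat 3 (color s p)) →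
      ∃ σ : Equiv.Perm (Fin 3), ∀ p < v, ψ p = σ (Fin.ofNat 3 (color s p)) := fun σ hσ =>
    ⟨σ.symm, fun p hp => by rw [← hσ p hp]; simp⟩
  by_cases hc : ψ x = ψ y
  · obtain ⟨σ, s0, s1⟩ := exists_perm_apply (c := 0) (d := 1)
      ((hv.properOn_iff.1 hψ x hx y hy hxy hc).symm) (by decide)
    refine fin σ (eq_color_of_searchFrom (hψ.comp σ) h2 ?_ ?_ (by simp))
    · simp [hx, hy, ← hc, s0]
    · simp [hv.lt x hx y hy hxy, s1]
  · obtain ⟨σ, s0, s1⟩ := exists_perm_apply (c := 0) (d := 1) hc (by decide)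
    refine fin σ (eq_color_of_searchFrom (hψ.comp σ) h1 ?_ ?_ (by simp))
    · simp [hx, s0]
    · simp [hy, s1]

/-- The image of the point `p` of a subsystem: `0` is fixed, the others are shifted by `d`. -/
def shift (d p : ℕ) : ℕ := Nat.rec 0 (fun k _ => Nat.add (Nat.succ k) d) p

/-- The points of color `c` of a subsystem. -/
def subColor (v s d c : ℕ) : List ℕ :=
  ((List.range v).filter fun p => Nat.beq (color s p) c).map (shift d)

/-- The table `tbl'` of order `v'` is a colored subsystem of `tbl`, on the points `shift d p`. -/
def checkSub (tbl v s tbl' v' s' d : ℕ) : Bool :=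
  allBelow (fun p => force (fun fp => Nat.blt fp v && (Nat.beq (color s fp) (color s' p) &&
    allBelow (fun q => Nat.beq p q ||
      Nat.beq (entry tbl v fp (shift d q)) (Nat.shiftLeft 1 (shift d (third tbl' v' p q)))) v'))
    (shift d p)) v'

/-- Rigidity, by a search that starts from a rigid subsystem. -/
def checkRigidFromSub (tbl v s tbl' v' s' d : ℕ) : Bool :=
  checkSub tbl v s tbl' v' s' d &&
    searchFrom tbl v s (subColor v' s' d 0) (subColor v' s' d 1) (subColor v' s' d 2)

/-- A proper coloring restricts to a proper coloring of the subsystem, where it is a permuted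
standard coloring. After undoing the permutation, the colors of the whole subsystem are known at the
start of the search. -/
theorem Rigid.of_checkFromSub {tbl v s tbl' v' s' d : ℕ} (hv' : Valid tbl' v' s')
    (hr' : Rigid tbl' v' s') (h : checkRigidFromSub tbl v s tbl' v' s' d = true) :
    Rigid tbl v s := by
  intro ψ hψ
  rw [checkRigidFromSub, Bool.and_eq_true] at h
  obtain ⟨hsub, hs⟩ := h
  have key := of_allBelow hsub
  simp only [force_eq, Bool.and_eq_true, Nat.blt_eq, Nat.beq_eq] at key
  have hent : ∀ p < v', ∀ q < v', p ≠ q →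
      entry tbl v (shift d p) (shift d q) = 1 <<< shift d (third tbl' v' p q) := by
    intro p hp q hq hpq
    have := of_allBelow (key p hp).2.2 q hq
    simp only [Bool.or_eq_true, Nat.beq_eq] at this
    exact this.resolve_left hpq
  have hψ' : ProperOn tbl' v' (ψ ∘ shift d) := by
    rw [hv'.properOn_iff]
    intro p hp q hq hpq hc ht
    have hb : (entry tbl v (shift d p) (shift d q)).testBit (shift d (third tbl' v' p q))
        = true := by
      rw [hent p hp q hq hpq, Nat.one_shiftLeft, Nat.testBit_two_pow_self]
    rw [testBit_entry] at hb
    exact hψ _ (key p hp).1 _ (key q hq).1 _ hb.1 hb.2 ⟨hc, ht⟩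
  obtain ⟨σ, hσ⟩ := hr' _ hψ'
  have hk : ∀ c : Fin 3, ∀ x ∈ subColor v' s' d c, x < v ∧ (σ.symm ∘ ψ) x = c := by
    intro c x hx
    obtain ⟨p, hp, rfl⟩ := List.mem_map.1 hx
    rw [List.mem_filter, List.mem_range, Nat.beq_eq] at hp
    refine ⟨(key p hp.1).1, ?_⟩
    have := hσ p hp.1
    simp only [Function.comp_apply] at this ⊢
    rw [this, Equiv.symm_apply_apply, hp.2]
    ext
    simp
  have := eq_color_of_searchFrom (hψ.comp σ.symm) hs (hk 0) (hk 1) (hk 2)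
  exact ⟨σ, fun p hp => by rw [← this p hp]; simp⟩

/-- The table bits of the ordered triple `p`, `q`, `r`. -/
def tripleBit (v p q r : ℕ) : ℕ :=
  Nat.shiftLeft 1 (Nat.add (Nat.mul (Nat.add (Nat.mul p v) q) v) r)

def addTriple (v tbl p q r : ℕ) : ℕ :=
  Nat.lor (Nat.lor (Nat.lor tbl (Nat.lor (tripleBit v p q r) (tripleBit v q p r)))
    (Nat.lor (tripleBit v p r q) (tripleBit v r p q)))
    (Nat.lor (tripleBit v q r p) (tripleBit v r q p))

/-- The table of the `n` triples given by the base `128` digits of `data`. -/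
def table (v data n : ℕ) : ℕ :=
  Nat.rec (motive := fun _ => ℕ → ℕ → ℕ) (fun _ tbl => tbl)
    (fun _ k data tbl => force (fun tbl => force (fun data => k data tbl)
      (Nat.shiftRight data 21))
      (addTriple v tbl (Nat.land data 127) (Nat.land (Nat.shiftRight data 7) 127)
        (Nat.land (Nat.shiftRight data 14) 127))) n data 0

end

end TripleTable

/-! ### Colored Steiner quasigroups and the filling construction -/

namespace ColoredSteiner

/-- The points: `w` fixed points, and six points for each element of `A`. -/
abbrev Point (w : ℕ) (A : Type) : Type := Fin w ⊕ A × Fin 6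

/-- The color of one of six points. -/
def sixColor (k : Fin 6) : Fin 3 := Fin.ofNat 3 k

/-- The color of a point. -/
def color {w : ℕ} {A : Type} : Point w A → Fin 3 :=
  Sum.elim (fun i => Fin.ofNat 3 i) fun x => sixColor x.2

/-- `ψ` is not constant on a line `x`, `y`, `op x y`. -/
def IsProper {P : Type} (op : P → P → P) (ψ : P → Fin 3) : Prop :=
  ∀ x y, x ≠ y → ψ x = ψ y → ψ (op x y) ≠ ψ x

/-- A Steiner quasigroup on `Point w A` that is properly colored by `color` and in which the fixed
points form a subsystem. -/
structure System (w : ℕ) [NeZero w] (A : Type) where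
  op : Point w A → Point w A → Point w A
  op_self : ∀ x, op x x = x
  op_comm : ∀ x y, op y x = op x y
  op_op : ∀ x y, op x (op x y) = y
  -- For `w = 3` this is the block of the three fixed points, for `w = 1` it is trivial. A formula
  -- common to all systems makes them agree on the fixed points when several are glued together.
  op_inl : ∀ i j, op (Sum.inl i) (Sum.inl j) = Sum.inl (-(i + j))
  proper : IsProper op color

variable {w : ℕ} {A B : Type}

/-- All proper `3`-colorings arise from `color` by a permutation of the colors. -/
def System.Rigid [NeZero w] (F : System w A) : Prop :=
  ∀ ψ, IsProper F.op ψ → ∃ σ : Equiv.Perm (Fin 3), ∀ x, ψ x = σ (color x)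

/-- The bijection between the points induced by a bijection `A ≃ B`. -/
def pointEquiv (w : ℕ) (e : A ≃ B) : Point w A ≃ Point w B :=
  Equiv.sumCongr (Equiv.refl _) (Equiv.prodCongr e (Equiv.refl _))

theorem color_pointEquiv (e : A ≃ B) (x : Point w A) : color (pointEquiv w e x) = color x := by
  rcases x with i | ⟨a, k⟩ <;> rfl

theorem color_pointEquiv_symm (e : A ≃ B) (x : Point w B) :
    color ((pointEquiv w e).symm x) = color x := by
  rcases x with i | ⟨a, k⟩ <;> rfl

/-- Transport along a bijection. -/
def System.transport [NeZero w] (F : System w A) (e : A ≃ B) : System w B where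
  op x y := pointEquiv w e (F.op ((pointEquiv w e).symm x) ((pointEquiv w e).symm y))
  op_self x := by simp [F.op_self]
  op_comm x y := by simp [F.op_comm]
  op_op x y := by simp [F.op_op]
  op_inl i j := congrArg (pointEquiv w e) (F.op_inl i j)
  proper x y hxy hc := by
    rw [color_pointEquiv, ← color_pointEquiv_symm e x]
    rw [← color_pointEquiv_symm e x, ← color_pointEquiv_symm e y] at hc
    exact F.proper _ _ (by simpa using hxy) hc

theorem System.Rigid.transport [NeZero w] {F : System w A} (h : F.Rigid) (e : A ≃ B) :
    (F.transport e).Rigid := by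
  intro ψ hψ
  obtain ⟨σ, hσ⟩ := h (ψ ∘ pointEquiv w e) fun x y hxy hc ht =>
    hψ (pointEquiv w e x) (pointEquiv w e y) (by simpa using hxy) hc
      (by simpa [System.transport] using ht)
  refine ⟨σ, fun x => ?_⟩
  have := hσ ((pointEquiv w e).symm x)
  rwa [color_pointEquiv_symm, Function.comp_apply, Equiv.apply_symm_apply] at this

/-! #### Filling the groups of a group divisible design -/

section Fill

variable {J : Type} {A : J → Type}

/-- The inclusion of a group, together with the fixed points. -/
def lift (w : ℕ) (j : J) : Point w (A j) → Point w (Σ j, A j) :=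
  Sum.map id (Prod.map (Sigma.mk j) id)

theorem lift_injective (j : J) : Function.Injective (lift w j : Point w (A j) → _) :=
  Function.Injective.sumMap Function.injective_id
    (Function.Injective.prodMap sigma_mk_injective Function.injective_id)

theorem color_lift (j : J) (x : Point w (A j)) : color (lift w j x) = color x := by
  rcases x with i | ⟨a, k⟩ <;> rfl

theorem eq_of_lift_eq {j k : J} (hjk : j ≠ k) {x : Point w (A j)} {y : Point w (A k)}
    (h : lift w j x = lift w k y) : ∃ i : Fin w, x = Sum.inl i ∧ y = Sum.inl i := by
  rcases x with i | ⟨a, k⟩ <;> rcases y with i' | ⟨a', k'⟩ <;>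
    simp only [lift, Sum.map_inl, Sum.map_inr, Sum.inl.injEq, Sum.inr.injEq, reduceCtorEq,
      Prod.map_apply, Prod.mk.injEq, Sigma.mk.injEq, id] at h
  · exact ⟨i, rfl, by rw [h]⟩
  · exact absurd h.1.1 hjk

/-- This case distinction drives the filling: a pair lies in one group with the fixed points, or it
crosses two groups and is covered by the design. -/
theorem lift_or_ne [Nonempty J] (x y : Point w (Σ j, A j)) :
    (∃ j, ∃ x' y' : Point w (A j), x = lift w j x' ∧ y = lift w j y') ∨
      ∃ a b, x = Sum.inr a ∧ y = Sum.inr b ∧ a.1.1 ≠ b.1.1 := by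
  rcases x with i | ⟨⟨j, a⟩, k⟩ <;> rcases y with i' | ⟨⟨j', a'⟩, k'⟩
  · exact Or.inl ⟨Classical.arbitrary J, Sum.inl i, Sum.inl i', rfl, rfl⟩
  · exact Or.inl ⟨j', Sum.inl i, Sum.inr (a', k'), rfl, rfl⟩
  · exact Or.inl ⟨j, Sum.inr (a, k), Sum.inl i', rfl, rfl⟩
  · by_cases h : j = j'
    · subst h
      exact Or.inl ⟨j, Sum.inr (a, k), Sum.inr (a', k'), rfl, rfl⟩
    · exact Or.inr ⟨_, _, rfl, rfl, h⟩

/-- A group divisible design with groups `A j × Fin 6`, properly colored: the relation `R x y z`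
says that `{x, y, z}` is a block. -/
structure IsDesign (R : (Σ j, A j) × Fin 6 → (Σ j, A j) × Fin 6 → (Σ j, A j) × Fin 6 → Prop) :
    Prop where
  exists_third : ∀ x y, x.1.1 ≠ y.1.1 → ∃ z, R x y z
  unique : ∀ x y z z', R x y z → R x y z' → z = z'
  left : ∀ x y z, R x y z → R y x z
  right : ∀ x y z, R x y z → R x z y
  group_ne : ∀ x y z, R x y z → x.1.1 ≠ y.1.1
  proper : ∀ x y z, R x y z → sixColor x.2 = sixColor y.2 → sixColor z.2 ≠ sixColor x.2

variable [NeZero w] (F : ∀ j, System w (A j))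
  {R : (Σ j, A j) × Fin 6 → (Σ j, A j) × Fin 6 → (Σ j, A j) × Fin 6 → Prop}

open Classical in
/-- The operation of the filled design. -/
noncomputable def fillOp (hR : IsDesign R) (x y : Point w (Σ j, A j)) : Point w (Σ j, A j) :=
  if h : ∃ j, ∃ x' y' : Point w (A j), lift w j x' = x ∧ lift w j y' = y then
    lift w h.choose ((F h.choose).op h.choose_spec.choose h.choose_spec.choose_spec.choose)
  else match x, y with
    | Sum.inr a, Sum.inr b =>
      if h : a.1.1 ≠ b.1.1 then Sum.inr (hR.exists_third a b h).choose else Sum.inr a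
    | x, _ => x

/-- The group chosen in `fillOp` may differ from `j`, but then both points are fixed points, since
different groups share nothing else. On fixed points all systems agree by `op_inl`. -/
theorem fillOp_lift (hR : IsDesign R) (j : J) (x y : Point w (A j)) :
    fillOp F hR (lift w j x) (lift w j y) = lift w j ((F j).op x y) := by
  have h : ∃ k, ∃ x' y' : Point w (A k), lift w k x' = lift w j x ∧ lift w k y' = lift w j y :=
    ⟨j, x, y, rfl, rfl⟩
  rw [fillOp, dif_pos h]
  have hx := h.choose_spec.choose_spec.choose_spec.1
  have hy := h.choose_spec.choose_spec.choose_spec.2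
  generalize h.choose_spec.choose_spec.choose = y' at *
  generalize h.choose_spec.choose = x' at *
  generalize h.choose = k at *
  by_cases hk : k = j
  · subst hk
    rw [lift_injective k hx, lift_injective k hy]
  · obtain ⟨a, rfl, rfl⟩ := eq_of_lift_eq hk hx
    obtain ⟨b, rfl, rfl⟩ := eq_of_lift_eq hk hy
    rw [(F k).op_inl, (F j).op_inl]
    rfl

theorem fillOp_inr (hR : IsDesign R) {a b : (Σ j, A j) × Fin 6} (h : a.1.1 ≠ b.1.1) :
    ∃ c, R a b c ∧ fillOp F hR (Sum.inr a) (Sum.inr b) = Sum.inr c := by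
  refine ⟨(hR.exists_third a b h).choose, (hR.exists_third a b h).choose_spec, ?_⟩
  have hn : ¬ ∃ j, ∃ x' y' : Point w (A j),
      lift w j x' = Sum.inr a ∧ lift w j y' = Sum.inr b := by
    rintro ⟨j, x', y', hx, hy⟩
    rcases x' with i | ⟨x', k⟩
    · exact absurd hx (by simp [lift])
    rcases y' with i | ⟨y', k⟩
    · exact absurd hy (by simp [lift])
    rw [lift, Sum.map_inr, Sum.inr.injEq] at hx hy
    exact h (by rw [← hx, ← hy]; rfl)
  rw [fillOp, dif_neg hn]
  exact dif_pos h

theorem fillOp_of_rel (hR : IsDesign R) {a b c : (Σ j, A j) × Fin 6} (h : R a b c) :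
    fillOp F hR (Sum.inr a) (Sum.inr b) = Sum.inr c := by
  obtain ⟨c', hc', e⟩ := fillOp_inr F hR (hR.group_ne _ _ _ h)
  rw [e, hR.unique _ _ _ _ h hc']

/-- The system obtained by filling the groups of a design. -/
noncomputable def fill [Nonempty J] (hR : IsDesign R) : System w (Σ j, A j) where
  op := fillOp F hR
  op_self x := by
    rcases lift_or_ne x x with ⟨j, x', y', rfl, h⟩ | ⟨a, b, rfl, h, hn⟩
    · rw [fillOp_lift, (F j).op_self]
    · exact absurd (congrArg (fun c => c.1.1) (Sum.inr.inj h)) hn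
  op_comm x y := by
    rcases lift_or_ne x y with ⟨j, x', y', rfl, rfl⟩ | ⟨a, b, rfl, rfl, hn⟩
    · rw [fillOp_lift, fillOp_lift, (F j).op_comm]
    · obtain ⟨c, hc, e⟩ := fillOp_inr F hR hn
      rw [e, fillOp_of_rel F hR (hR.left _ _ _ hc)]
  op_op x y := by
    rcases lift_or_ne x y with ⟨j, x', y', rfl, rfl⟩ | ⟨a, b, rfl, rfl, hn⟩
    · rw [fillOp_lift, fillOp_lift, (F j).op_op]
    · obtain ⟨c, hc, e⟩ := fillOp_inr F hR hn
      rw [e, fillOp_of_rel F hR (hR.right _ _ _ hc)]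
  op_inl i j :=
    (fillOp_lift F hR (Classical.arbitrary J) (Sum.inl i) (Sum.inl j)).trans
      (congrArg (lift w _) ((F _).op_inl i j))
  proper x y hxy hc := by
    rcases lift_or_ne x y with ⟨j, x', y', rfl, rfl⟩ | ⟨a, b, rfl, rfl, hn⟩
    · rw [fillOp_lift, color_lift, color_lift]
      rw [color_lift, color_lift] at hc
      exact (F j).proper _ _ (fun e => hxy (by rw [e])) hc
    · obtain ⟨c, hc', e⟩ := fillOp_inr F hR hn
      rw [e]
      exact hR.proper _ _ _ hc' hc

theorem isProper_comp_lift [Nonempty J] (hR : IsDesign R) {ψ : Point w (Σ j, A j) → Fin 3}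
    (h : IsProper (fill F hR).op ψ) (j : J) : IsProper (F j).op (ψ ∘ lift w j) := by
  intro x y hxy hc
  have := h (lift w j x) (lift w j y) (fun e => hxy (lift_injective j e)) hc
  change ψ (fillOp F hR _ _) ≠ _ at this
  rwa [fillOp_lift] at this

theorem ne_of_rel [Nonempty J] (hR : IsDesign R) {ψ : Point w (Σ j, A j) → Fin 3}
    (h : IsProper (fill F hR).op ψ) {a b c : (Σ j, A j) × Fin 6} (hr : R a b c)
    (hab : ψ (Sum.inr a) = ψ (Sum.inr b)) : ψ (Sum.inr c) ≠ ψ (Sum.inr a) := by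
  have := h (Sum.inr a) (Sum.inr b)
    (fun e => hR.group_ne _ _ _ hr (by rw [Sum.inr.inj e])) hab
  change ψ (fillOp F hR _ _) ≠ _ at this
  rwa [fillOp_of_rel F hR hr] at this

end Fill

end ColoredSteiner

namespace ColoredSteiner

/-! ### The local structure of a line

A line with four points is inflated to the nonzero vectors of `𝔽₃ × 𝔽₃` (two for each direction),
with the lines that avoid the origin as blocks, and a line with three points to the Klein four-group;
then each point is tripled, one copy for each color. -/

/-- The direction with index `i` in the plane over `𝔽₃`, with a sign. -/
def vec (p : Fin 4 × Fin 2) : Fin 3 × Fin 3 :=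
  let d : Fin 3 × Fin 3 := match p.1 with
    | 0 => (1, 0)
    | 1 => (0, 1)
    | 2 => (1, 1)
    | 3 => (1, 2)
  if p.2 = 0 then d else -d

/-- The index and the sign of a nonzero vector of the plane over `𝔽₃`. -/
def unvec : Fin 3 × Fin 3 → Fin 4 × Fin 2
  | (1, 0) => (0, 0)
  | (2, 0) => (0, 1)
  | (0, 1) => (1, 0)
  | (0, 2) => (1, 1)
  | (1, 1) => (2, 0)
  | (2, 2) => (2, 1)
  | (1, 2) => (3, 0)
  | (2, 1) => (3, 1)
  | (0, 0) => (0, 0)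

/-- The sign of one of six points. -/
def sixSign (k : Fin 6) : Fin 2 := if k < 3 then 0 else 1

/-- The point with the given sign and color. -/
def six (e : Fin 2) (c : Fin 3) : Fin 6 := ⟨3 * e + c, by omega⟩

/-- The third point on a line of four (if `b`) or three points. -/
def localOp (b : Bool) (p q : Fin 4 × Fin 6) : Fin 4 × Fin 6 :=
  if b then
    let r := unvec (-(vec (p.1, sixSign p.2) + vec (q.1, sixSign q.2)))
    -- The colors of a block sum to `t`. As `t ≠ 0` and three equal colors sum to `0`, no block is
    -- monochromatic. Two points of color `d` force the third color `d + t`; both values of `t`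
    -- occur on blocks through the fourth direction, so that there each of the two wrong colors can
    -- be ruled out.
    let t : Fin 3 := if p.1 ≠ 1 ∧ q.1 ≠ 1 ∧ r.1 ≠ 1 then 2 else 1
    (r.1, six r.2 (t - sixColor p.2 - sixColor q.2))
  else (3 - p.1 - q.1, six (sixSign p.2 + sixSign q.2) (1 - sixColor p.2 - sixColor q.2))

/-- Vectors of different directions are joined by an affine line that avoids the origin; its third
point is minus their sum and has yet another direction. On three-point lines the signs sum to zero.
Block membership is thus given by symmetric sum conditions on signs or vectors and on colors, whence
commutativity and the involution law. -/
theorem localOp_spec : ∀ (b : Bool) (i j : Fin 4) (k l : Fin 6), i ≠ j →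
    (b = false → i ≠ 3 ∧ j ≠ 3) →
      (i ≠ (localOp b (i, k) (j, l)).1 ∧ (b = false → (localOp b (i, k) (j, l)).1 ≠ 3)) ∧
      localOp b (j, l) (i, k) = localOp b (i, k) (j, l) ∧
      localOp b (i, k) (localOp b (i, k) (j, l)) = (j, l) ∧
      (sixColor k = sixColor l → sixColor (localOp b (i, k) (j, l)).2 ≠ sixColor k) := by
  decide +kernel

/-- On the first three points, all combinations of colors with sum `1` occur. -/
theorem exists_localOp_colors : ∀ (b : Bool) (c d : Fin 3), ∃ k l m : Fin 6,
    localOp b (0, k) (1, l) = (2, m) ∧ sixColor k = c ∧ sixColor l = d ∧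
      sixColor m = 1 - c - d := by
  decide +kernel

/-- Each copy of the fourth point lies on a block with two points of any other color. -/
theorem exists_localOp_fourth : ∀ (m : Fin 6) (d : Fin 3), d ≠ sixColor m →
    ∃ i j : Fin 4, ∃ k l : Fin 6, i ≠ j ∧ i ≠ 3 ∧ j ≠ 3 ∧
      localOp true (i, k) (j, l) = (3, m) ∧ sixColor k = d ∧ sixColor l = d := by
  decide +kernel

/-- The inverse permutations agree at the common image of `g`, and on the other two colors each
takes the remaining values `h`, `h'` in one of two orders. If the orders are not all the same, two
agree against one, and the sums over the three inverses at these colors are `2 h + h' = h' - h` and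
`2 h' + h = h - h'`. One of these is `1`, which is a forbidden coincidence. -/
theorem perm_eq_of_ne : ∀ (g : Fin 3) (σ₀ σ₁ σ₂ : Equiv.Perm (Fin 3)), σ₀ g = σ₁ g →
    σ₁ g = σ₂ g → (∀ c d, ¬ (σ₀ c = σ₁ d ∧ σ₂ (1 - c - d) = σ₀ c)) → σ₀ = σ₁ ∧ σ₁ = σ₂ := by
  decide +kernel

/-! ### The recursive construction -/

section Recursion

variable {R : Type} [CommRing R]

/-- The `i`-th point of a line. -/
def pos (u : R) (l : R × R) (i : Fin 4) : R :=
  match i with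
  | 0 => l.1
  | 1 => l.2
  | 2 => l.1 + l.2
  | 3 => l.1 + u * l.2

/-- The coordinates at positions `i` and `j` are two linear forms in the pair `l`. Their
determinants are, up to sign, `1`, `u` or `u - 1`, hence units. -/
theorem line_ext {u : R} (hu : IsUnit u) (hu' : IsUnit (u - 1)) {i j : Fin 4} (hij : i ≠ j)
    {l m : R × R} (hi : pos u l i = pos u m i) (hj : pos u l j = pos u m j) : l = m := by
  wlog h : i < j generalizing i j
  · exact this hij.symm hj hi (lt_of_le_of_ne (not_lt.1 h) hij.symm)
  obtain ⟨x, y⟩ := l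
  obtain ⟨x', y'⟩ := m
  have fin6 : ∀ i j : Fin 4, i < j → (i = 0 ∧ j = 1) ∨ (i = 0 ∧ j = 2) ∨ (i = 0 ∧ j = 3) ∨
      (i = 1 ∧ j = 2) ∨ (i = 1 ∧ j = 3) ∨ (i = 2 ∧ j = 3) := by decide
  have key : y = y' ∧ x = x' := by
    rcases fin6 i j h with ⟨rfl, rfl⟩ | ⟨rfl, rfl⟩ | ⟨rfl, rfl⟩ | ⟨rfl, rfl⟩ | ⟨rfl, rfl⟩ |
        ⟨rfl, rfl⟩ <;> simp only [pos] at hi hj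
    · exact ⟨hj, hi⟩
    · subst hi; exact ⟨add_left_cancel hj, rfl⟩
    · subst hi; exact ⟨hu.mul_left_cancel (add_left_cancel hj), rfl⟩
    · subst hi; exact ⟨rfl, add_right_cancel hj⟩
    · subst hi; exact ⟨rfl, add_right_cancel hj⟩
    · have hy : y = y' := hu'.mul_left_cancel (by linear_combination hj - hi)
      subst hy; exact ⟨rfl, add_right_cancel hi⟩
  rw [key.1, key.2]

theorem exists_line [Finite R] {u : R} (hu : IsUnit u) (hu' : IsUnit (u - 1)) {i j : Fin 4}
    (hij : i ≠ j) (r s : R) : ∃ l, pos u l i = r ∧ pos u l j = s := by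
  have hinj : Function.Injective fun l : R × R => (pos u l i, pos u l j) := fun l m h =>
    line_ext hu hu' hij (congrArg Prod.fst h) (congrArg Prod.snd h)
  obtain ⟨l, hl⟩ := Finite.surjective_of_injective hinj (r, s)
  exact ⟨l, congrArg Prod.fst hl, congrArg Prod.snd hl⟩

/-- The groups of the truncated transversal design. -/
abbrev Group (T : Finset R) (i : Fin 4) : Type := {r : R // i = 3 → r ∈ T}

variable [DecidableEq R]

/-- The blocks of the inflated truncated transversal design. -/
def IsBlock (u : R) (T : Finset R) (x y z : (Σ i, Group T i) × Fin 6) : Prop :=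
  ∃ l : R × R, x.1.2.1 = pos u l x.1.1 ∧ y.1.2.1 = pos u l y.1.1 ∧ z.1.2.1 = pos u l z.1.1 ∧
    x.1.1 ≠ y.1.1 ∧ localOp (decide (pos u l 3 ∈ T)) (x.1.1, x.2) (y.1.1, y.2) = (z.1.1, z.2)

/-- A line whose fourth point is cut off has only three points, so the value `false` of the flag
means that index `3` does not occur on it. -/
theorem ne_three {u : R} {T : Finset R} {l : R × R} {x : (Σ i, Group T i) × Fin 6}
    (hx : x.1.2.1 = pos u l x.1.1) (h : decide (pos u l 3 ∈ T) = false) : x.1.1 ≠ 3 := by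
  intro h3
  have := x.1.2.2 h3
  rw [hx, h3] at this
  exact (of_decide_eq_false h) this

theorem isDesign [Finite R] {u : R} (hu : IsUnit u) (hu' : IsUnit (u - 1)) (T : Finset R) :
    IsDesign (IsBlock u T) where
  exists_third x y hxy := by
    obtain ⟨l, hx, hy⟩ := exists_line hu hu' hxy x.1.2.1 y.1.2.1
    have h := localOp_spec (decide (pos u l 3 ∈ T)) x.1.1 y.1.1 x.2 y.2 hxy
      fun hb => ⟨ne_three hx.symm hb, ne_three hy.symm hb⟩
    refine ⟨⟨⟨_, pos u l (localOp (decide (pos u l 3 ∈ T)) (x.1.1, x.2) (y.1.1, y.2)).1, ?_⟩, _⟩,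
      l, hx.symm, hy.symm, rfl, hxy, rfl⟩
    have key : ∀ j : Fin 4, j = 3 → pos u l 3 ∈ T → pos u l j ∈ T := by
      rintro _ rfl hT
      exact hT
    intro h3
    refine key _ h3 ?_
    by_contra hT
    exact h.1.2 (decide_eq_false hT) h3
  unique := by
    rintro x y ⟨⟨i, r, hr⟩, k⟩ ⟨⟨i', r', hr'⟩, k'⟩ ⟨l, hx, hy, hz, hxy, e⟩
      ⟨l', hx', hy', hz', -, e'⟩
    obtain rfl := line_ext hu hu' hxy (hx.symm.trans hx') (hy.symm.trans hy')
    have ee := e.symm.trans e'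
    rw [Prod.mk.injEq] at ee
    obtain ⟨h1, h2⟩ := ee
    dsimp only at h1 h2 hz hz'
    subst h1 h2 hz hz'
    rfl
  left := by
    rintro x y z ⟨l, hx, hy, hz, hxy, e⟩
    refine ⟨l, hy, hx, hz, hxy.symm, ?_⟩
    rw [← e]
    exact (localOp_spec _ _ _ _ _ hxy fun hb => ⟨ne_three hx hb, ne_three hy hb⟩).2.1
  right := by
    rintro x y z ⟨l, hx, hy, hz, hxy, e⟩
    have h := localOp_spec (decide (pos u l 3 ∈ T)) x.1.1 y.1.1 x.2 y.2 hxy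
      fun hb => ⟨ne_three hx hb, ne_three hy hb⟩
    rw [e] at h
    exact ⟨l, hx, hz, hy, h.1.1, h.2.2.1⟩
  group_ne := by
    rintro x y z ⟨l, hx, hy, hz, hxy, e⟩
    exact hxy
  proper := by
    rintro x y z ⟨l, hx, hy, hz, hxy, e⟩ hc
    have h := (localOp_spec (decide (pos u l 3 ∈ T)) x.1.1 y.1.1 x.2 y.2 hxy
      fun hb => ⟨ne_three hx hb, ne_three hy hb⟩).2.2.2 hc
    rwa [e] at h

variable {w : ℕ} [NeZero w]

/-- Rigidity of the first three groups suffices. Their permutations coincide by `perm_eq_of_ne`, and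
the fourth group is then forced point by point by `exists_localOp_fourth`. -/
theorem rigid_fill [Finite R] {u : R} (hu : IsUnit u) (hu' : IsUnit (u - 1)) (T : Finset R)
    (F : ∀ i, System w (Group T i)) (hF : ∀ i, i ≠ 3 → (F i).Rigid) :
    (fill F (isDesign hu hu' T)).Rigid := by
  intro ψ hψ
  have hD := isDesign hu hu' T
  choose σ hσ using fun i (hi : i ≠ 3) => hF i hi _ (isProper_comp_lift F hD hψ i)
  have hinr : ∀ (i : Fin 4) (hi : i ≠ 3) (r : Group T i) (k : Fin 6),
      ψ (Sum.inr (⟨i, r⟩, k)) = σ i hi (sixColor k) := fun i hi r k => hσ i hi (Sum.inr (r, k))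
  have hinl : ∀ (i : Fin 4) (hi : i ≠ 3) (a : Fin w),
      ψ (Sum.inl a) = σ i hi (color (Sum.inl a : Point w (Group T i))) := fun i hi a =>
    hσ i hi (Sum.inl a)
  have h01 : (0 : Fin 4) ≠ 3 := by decide
  have h11 : (1 : Fin 4) ≠ 3 := by decide
  have h21 : (2 : Fin 4) ≠ 3 := by decide
  have hblock : ∀ c d, ¬ (σ 0 h01 c = σ 1 h11 d ∧ σ 2 h21 (1 - c - d) = σ 0 h01 c) := by
    rintro c d ⟨hcd, hc⟩
    -- Any line would do, since within a group the color depends only on the index in `Fin 6`; the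
    -- line `(0, 0)` serves whether or not its fourth point is truncated.
    obtain ⟨k, l, m, e, rfl, rfl, hm⟩ := exists_localOp_colors (decide (pos u (0, 0) 3 ∈ T)) c d
    rw [← hm] at hc
    refine ne_of_rel F hD hψ (a := (⟨0, pos u (0, 0) 0, fun h => absurd h h01⟩, k))
      (b := (⟨1, pos u (0, 0) 1, fun h => absurd h h11⟩, l))
      (c := (⟨2, pos u (0, 0) 2, fun h => absurd h h21⟩, m))
      ⟨(0, 0), rfl, rfl, rfl, (by decide : (0 : Fin 4) ≠ 1), e⟩ ?_ ?_
    · rw [hinr 0 h01, hinr 1 h11, hcd]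
    · rw [hinr 0 h01, hinr 2 h21, hc]
  -- The fixed point `0` lies in every filled group, so the three permutations agree at its standard
  -- color.
  obtain ⟨e01, e12⟩ := perm_eq_of_ne (Fin.ofNat 3 (0 : Fin w)) (σ 0 h01) (σ 1 h11) (σ 2 h21)
    ((hinl 0 h01 0).symm.trans (hinl 1 h11 0)) ((hinl 1 h11 0).symm.trans (hinl 2 h21 0)) hblock
  have hall : ∀ i (hi : i ≠ 3), σ i hi = σ 0 h01 := by
    intro i hi
    have : ∀ i : Fin 4, i ≠ 3 → i = 0 ∨ i = 1 ∨ i = 2 := by decide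
    rcases this i hi with rfl | rfl | rfl
    · rfl
    · exact e01.symm
    · exact (e01.trans e12).symm
  refine ⟨σ 0 h01, ?_⟩
  rintro (a | ⟨⟨i, r⟩, k⟩)
  · exact hinl 0 h01 a
  · by_cases hi : i = 3
    · subst hi
      by_contra hne
      -- If the point had the color that `σ 0` assigns to some `d` other than its standard color, a
      -- block through it and two points of standard color `d` would be monochromatic.
      set d := (σ 0 h01).symm (ψ (Sum.inr (⟨3, r⟩, k))) with hd
      have hd' : d ≠ sixColor k := by
        intro h
        apply hne
        rw [Equiv.symm_apply_eq] at hd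
        exact (Equiv.symm_apply_eq _).1 h
      obtain ⟨i, j, m, n, hij, hi, hj, e, hm, hn⟩ := exists_localOp_fourth k d hd'
      -- The line `(r, 0)` has fourth point `r + u * 0 = r`, so it passes through the given point
      -- and is not truncated.
      have hr : r.1 = pos u (r.1, 0) 3 := by simp [pos]
      refine ne_of_rel F hD hψ (a := (⟨i, pos u (r.1, 0) i, fun h => absurd h hi⟩, m))
        (b := (⟨j, pos u (r.1, 0) j, fun h => absurd h hj⟩, n)) (c := (⟨3, r⟩, k))
        ⟨(r.1, 0), rfl, rfl, hr, hij, ?_⟩ ?_ ?_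
      · have hT : pos u (r.1, 0) 3 ∈ T := hr ▸ r.2 rfl
        simpa [hT] using e
      · rw [hinr i hi, hinr j hj, hall i hi, hall j hj, hm, hn]
      · rw [hinr i hi, hall i hi, hm, hd, Equiv.apply_symm_apply]
    · rw [hinr i hi, hall i hi]
      rfl

end Recursion

/-- There is a colored system with `6 * n + w` points. -/
def Exists (w n : ℕ) [NeZero w] : Prop := Nonempty (System w (Fin n))

/-- There is a rigid colored system with `6 * n + w` points. -/
def ExistsRigid (w n : ℕ) [NeZero w] : Prop := ∃ F : System w (Fin n), F.Rigid

theorem existsRigid_of_ring {R : Type} [CommRing R] [Fintype R] [DecidableEq R] {u : R}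
    (hu : IsUnit u) (hu' : IsUnit (u - 1)) {w : ℕ} [NeZero w] {t : ℕ} (ht : t ≤ Fintype.card R)
    (hm : ExistsRigid w (Fintype.card R)) (ht' : Exists w t) :
    ExistsRigid w (3 * Fintype.card R + t) := by
  obtain ⟨T, -, rfl⟩ := Finset.exists_subset_card_eq (s := (Finset.univ : Finset R)) (n := t)
    (by simpa using ht)
  obtain ⟨F, hF⟩ := hm
  obtain ⟨G⟩ := ht'
  have e : ∀ i : Fin 4, i ≠ 3 → Fintype.card (Group T i) = Fintype.card R := fun i hi =>
    Fintype.card_congr (Equiv.subtypeUnivEquiv fun r h => absurd h hi)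
  have e3 : Fintype.card (Group T 3) = T.card := by
    rw [← Fintype.card_coe T]
    exact Fintype.card_congr (Equiv.subtypeEquivRight fun r => by simp)
  let H : ∀ i, System w (Group T i) := fun i =>
    if h : i = 3 then G.transport (Fintype.equivFinOfCardEq (h ▸ e3)).symm
    else F.transport (Fintype.equivFinOfCardEq (e i h)).symm
  have hH : ∀ i, i ≠ 3 → (H i).Rigid := fun i h => by
    simp only [H, dif_neg h]
    exact hF.transport _
  have hcard : Fintype.card (Σ i, Group T i) = 3 * Fintype.card R + T.card := by
    rw [Fintype.card_sigma, Fin.sum_univ_four, e 0 (by decide), e 1 (by decide), e 2 (by decide),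
      e3]
    ring
  exact ⟨_, (rigid_fill hu hu' T H hH).transport (Fintype.equivFinOfCardEq hcard)⟩

end ColoredSteiner

namespace ColoredSteiner

/-! ### Systems from tables -/

section Table

open TripleTable in
/-- The fixed points form a subsystem of the table. -/
def FixedSub (w tbl v : ℕ) : Prop :=
  ∀ p < w, ∀ q < w, p ≠ q → third tbl v p q = 2 * (p + q) % w

/-- The numbering of the points. -/
def index (w n : ℕ) : Point w (Fin n) ≃ Fin (w + n * 6) :=
  (Equiv.sumCongr (Equiv.refl _) finProdFinEquiv).trans finSumFinEquiv

theorem index_inl {w n : ℕ} (i : Fin w) : (index w n (Sum.inl i) : ℕ) = i := by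
  simp [index]

theorem index_inr {w n : ℕ} (a : Fin n) (k : Fin 6) :
    (index w n (Sum.inr (a, k)) : ℕ) = w + (k + 6 * a) := by
  simp [index]

/-- The offset `w % 3` is `1` for `w = 1`, where truncated subtraction gives the points `0` and `1`
the same color, and `0` for `w = 3`. In both cases the groups of six start with color `0`. -/
theorem color_index {w n : ℕ} (hw : w = 1 ∨ w = 3) (x : Point w (Fin n)) :
    Fin.ofNat 3 (TripleTable.color (w % 3) (index w n x)) = color x := by
  have hc : ∀ s p, TripleTable.color s p = (p - s) % 3 := fun _ _ => rfl
  rcases x with i | ⟨a, k⟩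
  · ext
    have := i.isLt
    simp only [hc, index_inl, color, Sum.elim_inl, Fin.val_ofNat]
    rcases hw with rfl | rfl <;> omega
  · ext
    simp only [hc, index_inr, color, Sum.elim_inr, sixColor, Fin.val_ofNat]
    rcases hw with rfl | rfl <;> omega

theorem color_index_symm {w n : ℕ} (hw : w = 1 ∨ w = 3) (p : Fin (w + n * 6)) :
    color ((index w n).symm p) = Fin.ofNat 3 (TripleTable.color (w % 3) p) := by
  rw [← color_index hw, Equiv.apply_symm_apply]

variable {w n tbl : ℕ}

/-- The operation on numbered points that is given by a table. -/
def finOp {v s : ℕ} (h : TripleTable.Valid tbl v s) (p q : Fin v) : Fin v :=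
  if hpq : (p : ℕ) = q then p
  else ⟨TripleTable.third tbl v p q, h.lt p p.isLt q q.isLt hpq⟩

theorem finOp_of_ne {v s : ℕ} (h : TripleTable.Valid tbl v s) {p q : Fin v}
    (hpq : (p : ℕ) ≠ q) : (finOp h p q : ℕ) = TripleTable.third tbl v p q := by
  rw [finOp, dif_neg hpq]

theorem finOp_self {v s : ℕ} (h : TripleTable.Valid tbl v s) (p : Fin v) :
    finOp h p p = p := by
  rw [finOp, dif_pos rfl]

theorem finOp_comm {v s : ℕ} (h : TripleTable.Valid tbl v s) (p q : Fin v) :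
    finOp h q p = finOp h p q := by
  by_cases hpq : (p : ℕ) = q
  · rw [Fin.ext hpq]
  · ext
    rw [finOp_of_ne h hpq, finOp_of_ne h (Ne.symm hpq),
      h.comm p p.isLt q q.isLt hpq]

theorem finOp_finOp {v s : ℕ} (h : TripleTable.Valid tbl v s) (p q : Fin v) :
    finOp h p (finOp h p q) = q := by
  by_cases hpq : (p : ℕ) = q
  · rw [Fin.ext hpq, finOp_self, finOp_self]
  · ext
    have e := finOp_of_ne h hpq
    have hne : (p : ℕ) ≠ finOp h p q := by
      rw [e]; exact (h.ne_left p p.isLt q q.isLt hpq).symm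
    rw [finOp_of_ne h hne, e, h.inv p p.isLt q q.isLt hpq]

/-- The system given by a table. -/
def ofTable [NeZero w] (hw : w = 1 ∨ w = 3)
    (h : TripleTable.Valid tbl (w + n * 6) (w % 3)) (hf : FixedSub w tbl (w + n * 6)) :
    System w (Fin n) where
  op x y := (index w n).symm (finOp h (index w n x) (index w n y))
  op_self x := by simp [finOp_self]
  op_comm x y := by simp [finOp_comm h (index w n x)]
  op_op x y := by simp [finOp_finOp]
  op_inl i j := by
    rw [Equiv.symm_apply_eq]
    ext
    have hv : ((-(i + j) : Fin w) : ℕ) = (w - (i + j) % w) % w := by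
      rw [Fin.val_neg', Fin.val_add]
    rw [index_inl, hv]
    have hi := i.isLt
    have hj := j.isLt
    by_cases hij : (i : ℕ) = j
    · rw [Fin.ext hij, finOp_self, index_inl]
      rcases hw with rfl | rfl <;> omega
    · rw [finOp_of_ne h (by rwa [index_inl, index_inl]), index_inl, index_inl,
        hf i hi j hj hij]
      rcases hw with rfl | rfl <;> omega
  proper x y hxy hc ht := by
    have hne : (index w n x : ℕ) ≠ index w n y := fun e =>
      hxy ((index w n).injective (Fin.ext e))
    rw [color_index_symm hw, finOp_of_ne h hne, ← color_index hw] at ht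
    rw [← color_index hw, ← color_index hw] at hc
    have inj : ∀ {a b : ℕ}, Fin.ofNat 3 (TripleTable.color (w % 3) a) =
        Fin.ofNat 3 (TripleTable.color (w % 3) b) →
        TripleTable.color (w % 3) a = TripleTable.color (w % 3) b := by
      intro a b hab
      have := congrArg Fin.val hab
      simpa [Nat.mod_eq_of_lt (TripleTable.color_lt _ _)] using this
    exact h.proper _ (index w n x).isLt _ (index w n y).isLt hne (inj hc) (inj ht)

theorem rigid_ofTable [NeZero w] (hw : w = 1 ∨ w = 3)
    (h : TripleTable.Valid tbl (w + n * 6) (w % 3)) (hf : FixedSub w tbl (w + n * 6))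
    (hr : TripleTable.Rigid tbl (w + n * 6) (w % 3)) : (ofTable hw h hf).Rigid := by
  intro ψ hψ
  let f : ℕ → Fin 3 := fun p =>
    if hp : p < w + n * 6 then ψ ((index w n).symm ⟨p, hp⟩) else 0
  have hf' : ∀ x, f (index w n x) = ψ x := fun x => by simp [f]
  have hpr : TripleTable.ProperOn tbl (w + n * 6) f := by
    rw [h.properOn_iff]
    intro p hp q hq hpq hc ht
    have hne : (⟨p, hp⟩ : Fin (w + n * 6)) ≠ ⟨q, hq⟩ := fun e => hpq (congrArg Fin.val e)
    refine hψ ((index w n).symm ⟨p, hp⟩) ((index w n).symm ⟨q, hq⟩)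
      (fun e => hne ((index w n).symm.injective e)) ?_ ?_
    · simpa [f, hp, hq] using hc
    · have hl := h.lt p hp q hq hpq
      have e : (finOp h ⟨p, hp⟩ ⟨q, hq⟩) = ⟨TripleTable.third tbl (w + n * 6) p q, hl⟩ :=
        Fin.ext (finOp_of_ne h hpq)
      simp only [f, hp, hl, dif_pos] at ht
      simpa [ofTable, e] using ht
  obtain ⟨σ, hσ⟩ := hr f hpr
  exact ⟨σ, fun x => by rw [← hf', hσ _ (index w n x).isLt, color_index hw]⟩

end Table

/-! ### The checks -/

section Check

open TripleTable

/-- The check of `FixedSub`. -/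
def checkFixed (w tbl v : ℕ) : Bool :=
  allBelow (fun p => allBelow (fun q => Nat.beq p q ||
    Nat.beq (third tbl v p q) (Nat.mod (Nat.mul 2 (Nat.add p q)) w)) w) w

theorem FixedSub.of_check {w tbl v : ℕ} (h : checkFixed w tbl v = true) : FixedSub w tbl v := by
  intro p hp q hq hpq
  have := of_allBelow (of_allBelow h p hp) q hq
  simp only [Bool.or_eq_true, Nat.beq_eq] at this
  exact this.resolve_left hpq

/-- The table given by `data` is that of a colored system. -/
def checkSystem (w n data : ℕ) : Bool :=
  force (fun v => force (fun tbl => checkValid tbl v (w % 3) && checkFixed w tbl v)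
    (table v data (v * (v - 1) / 6))) (w + n * 6)

/-- The table given by `data` is that of a rigid colored system: the search starts from the last
points of the colors `0` and `1`. -/
def checkRigidSystem (w n data : ℕ) : Bool :=
  force (fun v => force (fun tbl => (checkValid tbl v (w % 3) && checkFixed w tbl v) &&
    checkRigid tbl v (w % 3) (v - 3) (v - 2)) (table v data (v * (v - 1) / 6))) (w + n * 6)

/-- The table given by `data` is that of a rigid colored system, with the subsystem of order `25`
given by `data'`. -/
def checkRigidSystemFromSub (w n data data' : ℕ) : Bool :=
  force (fun v => force (fun tbl => (checkValid tbl v (w % 3) && checkFixed w tbl v) &&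
    -- The subsystem of order `25` has `100` blocks and one fixed point, hence offset `1`. The shift
    -- by `w - 1` moves its other points past the `w` fixed points, which preserves colors.
    force (fun tbl' => checkRigidFromSub tbl v (w % 3) tbl' 25 1 (w - 1)) (table 25 data' 100))
      (table v data (v * (v - 1) / 6))) (w + n * 6)

variable {w n data : ℕ} [NeZero w]

theorem exists_of_check (hw : w = 1 ∨ w = 3) (h : checkSystem w n data = true) : Exists w n := by
  rw [checkSystem, force_eq, force_eq, Bool.and_eq_true] at h
  exact ⟨ofTable hw (Valid.of_check h.1) (FixedSub.of_check h.2)⟩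

theorem existsRigid_of_check (hw : w = 1 ∨ w = 3) (h : checkRigidSystem w n data = true) :
    ExistsRigid w n := by
  rw [checkRigidSystem, force_eq, force_eq, Bool.and_eq_true, Bool.and_eq_true] at h
  have hv := Valid.of_check h.1.1
  exact ⟨_, rigid_ofTable hw hv (FixedSub.of_check h.1.2) (hv.rigid_of_check h.2)⟩

theorem existsRigid_of_checkFromSub (hw : w = 1 ∨ w = 3) {data' : ℕ}
    (h' : checkRigidSystem 1 4 data' = true)
    (h : checkRigidSystemFromSub w n data data' = true) : ExistsRigid w n := by
  rw [checkRigidSystemFromSub, force_eq, force_eq, force_eq, Bool.and_eq_true,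
    Bool.and_eq_true] at h
  rw [checkRigidSystem, force_eq, force_eq, Bool.and_eq_true, Bool.and_eq_true] at h'
  have hv := Valid.of_check h.1.1
  have hv' := Valid.of_check h'.1.1
  exact ⟨_, rigid_ofTable hw hv (FixedSub.of_check h.1.2)
    (Rigid.of_checkFromSub hv' (hv'.rigid_of_check h'.2) h.2)⟩

end Check

end ColoredSteiner

/-! ### Colorings of Steiner triple systems -/

namespace SteinerTripleSystem

variable {V : Type*} (D : SteinerTripleSystem V)

theorem IsColoring.comp {C C' : Type*} {D : SteinerTripleSystem V} {φ : V → C}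
    (h : D.IsColoring φ) {f : C → C'} (hf : Function.Injective f) : D.IsColoring (f ∘ φ) := by
  intro B hB
  obtain ⟨x, hx, y, hy, hne⟩ := h B hB
  exact ⟨x, hx, y, hy, fun e => hne (hf e)⟩

theorem IsColoring.exists_ne [Nontrivial V] {C : Type*} {D : SteinerTripleSystem V} {φ : V → C}
    (h : D.IsColoring φ) : ∃ x y, φ x ≠ φ y := by
  obtain ⟨a, b, hab⟩ := exists_pair_ne V
  obtain ⟨B, ⟨hB, -⟩, -⟩ := D.existsUnique_block a b hab
  obtain ⟨x, -, y, -, hne⟩ := h B hB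
  exact ⟨x, y, hne⟩

/-- Some point has a color different from that of `x`, because a coloring is not constant. That
color is `a` or `b`, so the swap changes it. -/
theorem IsColoring.swap_ne [Nontrivial V] {D : SteinerTripleSystem V} {φ : V → Fin 3}
    (h : D.IsColoring φ) {x : V} {a b : Fin 3} (hab : a ≠ b) (ha : a ≠ φ x) (hb : b ≠ φ x) :
    Equiv.swap a b ∘ φ ≠ φ := by
  intro e
  obtain ⟨y, hy⟩ : ∃ y, φ y ≠ φ x := by
    by_contra! hall
    obtain ⟨y, z, hyz⟩ := h.exists_ne
    exact hyz ((hall y).trans (hall z).symm)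
  have key : ∀ a b c d : Fin 3, a ≠ b → a ≠ c → b ≠ c → d ≠ c → Equiv.swap a b d ≠ d := by
    decide
  exact key a b (φ x) (φ y) hab ha hb hy (congrFun e y)

theorem not_isDefiningSet_of_card_le_one [Nontrivial V] {S : Finset V} {c : S → Fin 3}
    (hS : S.card ≤ 1) : ¬ D.IsDefiningSet 3 S c := by
  rintro ⟨φ, ⟨hφ, hc⟩, huniq⟩
  obtain ⟨x, hx⟩ : ∃ x, S ⊆ {x} := by
    rcases Finset.card_le_one_iff_subset_singleton.1 hS with ⟨x, hx⟩
    exact ⟨x, hx⟩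
  obtain ⟨a, b, hab, ha, hb⟩ : ∃ a b : Fin 3, a ≠ b ∧ a ≠ φ x ∧ b ≠ φ x := by
    generalize φ x = d
    revert d
    decide
  refine hφ.swap_ne hab ha hb (huniq _ ⟨hφ.comp (Equiv.injective _), fun z => ?_⟩)
  have hz : (z : V) = x := Finset.mem_singleton.1 (hx z.2)
  rw [← hc z, Function.comp_apply, hz, Equiv.swap_apply_of_ne_of_ne ha.symm hb.symm]

/-- Another extension has the same color classes and the same colors on the classes of `x` and `y`;
only one color is left for all remaining points. -/
theorem IsUniquelyColorable.isDefiningSet [DecidableEq V] {D : SteinerTripleSystem V}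
    (h : D.IsUniquelyColorable 3) {φ : V → Fin 3} (hφ : D.IsColoring φ) {x y : V}
    (hxy : φ x ≠ φ y) : D.IsDefiningSet 3 {x, y} fun z => φ z := by
  refine ⟨φ, ⟨hφ, fun _ => rfl⟩, ?_⟩
  rintro ψ ⟨hψ, hc⟩
  have hx : ψ x = φ x := hc ⟨x, by simp⟩
  have hy : ψ y = φ y := hc ⟨y, by simp⟩
  have hker : ∀ a b, ψ a = ψ b ↔ φ a = φ b := by
    intro a b
    have := h.2 ψ φ hψ hφ
    rw [← Setoid.ker_def, ← Setoid.ker_def, this]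
  have key : ∀ a b c d : Fin 3, a ≠ b → (c = a ↔ d = a) → (c = b ↔ d = b) → c = d := by
    decide
  funext z
  have h1 := hker z x
  have h2 := hker z y
  rw [hx] at h1
  rw [hy] at h2
  exact key _ _ _ _ hxy h1 h2

theorem IsUniquelyColorable.isDefiningNumber [Nontrivial V] {D : SteinerTripleSystem V}
    (h : D.IsUniquelyColorable 3) : D.IsDefiningNumber 3 2 := by
  classical
  constructor
  · obtain ⟨φ, hφ⟩ := h.1.1
    obtain ⟨x, y, hxy⟩ := hφ.exists_ne
    exact ⟨{x, y}, fun z => φ z, h.isDefiningSet hφ hxy,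
      Finset.card_pair fun e => hxy (by rw [e])⟩
  · rintro k ⟨S, c, hS, rfl⟩
    by_contra hk
    exact D.not_isDefiningSet_of_card_le_one (by omega) hS

end SteinerTripleSystem

/-! ### From colored quasigroups to triple systems, and the induction on the order. -/

namespace ColoredSteiner

open SteinerTripleSystem

variable {w : ℕ} [NeZero w] {A V : Type}

theorem System.op_ne_left (F : System w A) {x y : Point w A} (h : x ≠ y) : F.op x y ≠ x := by
  intro e
  have := F.op_op x y
  rw [e, F.op_self] at this
  exact h this

theorem System.op_ne_right (F : System w A) {x y : Point w A} (h : x ≠ y) : F.op x y ≠ y := by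
  rw [← F.op_comm]
  exact F.op_ne_left h.symm

open Classical in
/-- The triple system on a type in bijection with the points. -/
noncomputable def System.toTriples [Fintype V] (F : System w A) (e : V ≃ Point w A) :
    SteinerTripleSystem V where
  blocks := (Finset.univ.filter fun x : V × V => x.1 ≠ x.2).image
    fun x => {x.1, x.2, e.symm (F.op (e x.1) (e x.2))}
  card_block B hB := by
    obtain ⟨⟨x, y⟩, hxy, rfl⟩ := Finset.mem_image.1 hB
    have hne : x ≠ y := (Finset.mem_filter.1 hxy).2
    have hne' : e x ≠ e y := fun h => hne (e.injective h)
    rw [Finset.card_eq_three]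
    refine ⟨x, y, _, hne, ?_, ?_, rfl⟩
    · rw [Ne, Equiv.eq_symm_apply]
      exact (F.op_ne_left hne').symm
    · rw [Ne, Equiv.eq_symm_apply]
      exact (F.op_ne_right hne').symm
  existsUnique_block x y hxy := by
    refine ⟨{x, y, e.symm (F.op (e x) (e y))}, ⟨?_, by simp, by simp⟩, ?_⟩
    · exact Finset.mem_image.2 ⟨(x, y), by simp [hxy], rfl⟩
    · rintro B ⟨hB, hx, hy⟩
      obtain ⟨⟨a, b⟩, hab, rfl⟩ := Finset.mem_image.1 hB
      have hne : a ≠ b := (Finset.mem_filter.1 hab).2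
      -- With `F.op (e a) (e b)` itself, these equations give all products of two distinct points of
      -- the block, so any two of its points generate the same block.
      have h1 : F.op (e b) (e a) = F.op (e a) (e b) := F.op_comm _ _
      have h2 : F.op (e a) (F.op (e a) (e b)) = e b := F.op_op _ _
      have h3 : F.op (F.op (e a) (e b)) (e a) = e b := by rw [← F.op_comm, h2]
      have h4 : F.op (e b) (F.op (e a) (e b)) = e a := by rw [← h1, F.op_op]
      have h5 : F.op (F.op (e a) (e b)) (e b) = e a := by rw [← F.op_comm, h4]
      simp only [Finset.mem_insert, Finset.mem_singleton] at hx hy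
      ext z
      simp only [Finset.mem_insert, Finset.mem_singleton]
      rcases hx with rfl | rfl | rfl <;> rcases hy with rfl | rfl | rfl <;>
        first
        | exact absurd rfl hxy
        | simp only [Equiv.apply_symm_apply, h1, h2, h3, h4, h5, Equiv.symm_apply_apply] <;> tauto

theorem System.isColoring_iff [Fintype V] (F : System w A) (e : V ≃ Point w A) {C : Type}
    {φ : V → C} : (F.toTriples e).IsColoring φ ↔
      ∀ x y, x ≠ y → φ x = φ y → φ (e.symm (F.op (e x) (e y))) ≠ φ x := by
  classical
  constructor
  · intro h x y hxy hc ht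
    obtain ⟨a, ha, b, hb, hne⟩ := h {x, y, e.symm (F.op (e x) (e y))}
      (Finset.mem_image.2 ⟨(x, y), by simp [hxy], by congr⟩)
    simp only [Finset.mem_insert, Finset.mem_singleton] at ha hb
    have key : ∀ a, (a = x ∨ a = y ∨ a = e.symm (F.op (e x) (e y))) → φ a = φ x := by
      rintro a (rfl | rfl | rfl)
      · rfl
      · exact hc.symm
      · exact ht
    exact hne ((key a ha).trans (key b hb).symm)
  · intro h B hB
    obtain ⟨⟨x, y⟩, hxy, rfl⟩ := Finset.mem_image.1 hB
    have hne : x ≠ y := (Finset.mem_filter.1 hxy).2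
    by_cases hc : φ x = φ y
    · exact ⟨_, by simp, x, by simp, h x y hne hc⟩
    · exact ⟨x, by simp, y, by simp, hc⟩

theorem color_surjective {w : ℕ} {A : Type} (hA : Nonempty A) :
    Function.Surjective (color : Point w A → Fin 3) := by
  intro c
  obtain ⟨a⟩ := hA
  have key : ∀ c, sixColor (six 0 c) = c := by decide
  exact ⟨Sum.inr (a, six 0 c), key c⟩

/-- Permuting colors does not change the classes, which gives uniqueness. A coloring with fewer
colors is also a 3-coloring, hence a permuted standard one, and so would use all three colors. -/
theorem System.Rigid.isUniquelyColorable [Fintype V] {F : System w A} (h : F.Rigid)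
    (hA : Nonempty A) (e : V ≃ Point w A) : (F.toTriples e).IsUniquelyColorable 3 := by
  have hall : ∀ φ : V → Fin 3, (F.toTriples e).IsColoring φ →
      ∃ σ : Equiv.Perm (Fin 3), ∀ x, φ x = σ (color (e x)) := by
    intro φ hφ
    rw [F.isColoring_iff] at hφ
    obtain ⟨σ, hσ⟩ := h (φ ∘ e.symm) fun x y hxy hc => by
      have := hφ (e.symm x) (e.symm y) (fun h => hxy (e.symm.injective h)) hc
      rwa [Equiv.apply_symm_apply, Equiv.apply_symm_apply] at this
    exact ⟨σ, fun x => by rw [← hσ]; simp⟩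
  refine ⟨⟨⟨fun x => color (e x), ?_⟩, ?_⟩, ?_⟩
  · rw [F.isColoring_iff]
    intro x y hxy hc
    rw [Equiv.apply_symm_apply]
    exact F.proper _ _ (fun h => hxy (e.injective h)) hc
  · rintro k ⟨φ, hφ⟩
    by_contra hk
    have hk3 : k ≤ 3 := by omega
    obtain ⟨σ, hσ⟩ := hall (Fin.castLE hk3 ∘ φ) (hφ.comp (Fin.castLE_injective hk3))
    -- A point of color `2` after the permutation is impossible for a coloring with values below `k
    -- ≤ 2`.
    obtain ⟨x, hx⟩ := color_surjective (w := w) hA (σ.symm 2)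
    have h2 := hσ (e.symm x)
    rw [Equiv.apply_symm_apply, hx, Equiv.apply_symm_apply] at h2
    have h3 := congrArg Fin.val h2
    have h4 := (φ (e.symm x)).isLt
    simp only [Function.comp_apply, Fin.val_castLE] at h3
    change _ = 2 at h3
    omega
  · intro φ ψ hφ hψ
    obtain ⟨σ, hσ⟩ := hall φ hφ
    obtain ⟨τ, hτ⟩ := hall ψ hψ
    ext x y
    rw [Setoid.ker_def, Setoid.ker_def, hσ, hσ, hτ, hτ, σ.injective.eq_iff, τ.injective.eq_iff]

theorem ExistsRigid.exists_isUniquelyColorable {n v : ℕ} (h : ExistsRigid w n) (hn : 0 < n)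
    (hv : v = w + n * 6) : ∃ D : SteinerTripleSystem (Fin v), D.IsUniquelyColorable 3 := by
  obtain ⟨F, hF⟩ := h
  subst hv
  exact ⟨_, hF.isUniquelyColorable ⟨⟨0, hn⟩⟩ (index w n).symm⟩

theorem ExistsRigid.exists {n : ℕ} (h : ExistsRigid w n) : Exists w n := by
  obtain ⟨F, -⟩ := h
  exact ⟨F⟩

/-- The recursion: from orders `6 * n + w` with `n < 12` to all orders. -/
theorem existsRigid_of_small (h0 : ∀ n < 4, Exists w n)
    (h1 : ∀ n, 4 ≤ n → n < 12 → ExistsRigid w n) (n : ℕ) (hn : 4 ≤ n) : ExistsRigid w n := by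
  induction n using Nat.strong_induction_on with
  | _ n ih =>
    have hex : ∀ t < n, Exists w t := fun t ht => by
      by_cases h4 : t < 4
      · exact h0 t h4
      · exact (ih t ht (by omega)).exists
    by_cases h12 : n < 12
    · exact h1 n hn h12
    by_cases h15 : n < 15
    -- For `n = 12, 13, 14` take `m = 4` and `t = n - 12`. Modulo `4` no unit `u` has `u - 1` a
    -- unit, so the field with four elements is used, with any `u` other than `0` and `1`.
    · classical
      have := Fintype.ofFinite (GaloisField 2 2)
      have hcard : Fintype.card (GaloisField 2 2) = 4 := by
        rw [← Nat.card_eq_fintype_card, GaloisField.card 2 2 (by decide)]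
        norm_num
      obtain ⟨u, hu⟩ : ∃ u : GaloisField 2 2, u ∉ ({0, 1} : Finset (GaloisField 2 2)) := by
        by_contra! hall
        have := Finset.card_le_card
          (fun x _ => hall x : Finset.univ ⊆ ({0, 1} : Finset (GaloisField 2 2)))
        rw [Finset.card_univ, hcard] at this
        exact absurd (this.trans Finset.card_le_two) (by decide)
      simp only [Finset.mem_insert, Finset.mem_singleton, not_or] at hu
      have := existsRigid_of_ring (w := w) (t := n - 12) (isUnit_iff_ne_zero.2 hu.1)
        (isUnit_iff_ne_zero.2 (sub_ne_zero.2 hu.2)) (by omega)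
        (by rw [hcard]; exact ih 4 (by omega) le_rfl) (hex _ (by omega))
      rw [hcard] at this
      convert this using 1
      omega
    -- Choose `m` odd with `0 ≤ n - 3 m ≤ 5`; `n ≥ 15` gives `m ≥ 5`, hence `t ≤ m`. For odd `m`,
    -- the element `u = 2` works modulo `m`, as `2` and `2 - 1 = 1` are units.
    · obtain ⟨m, t, hm, rfl, ht, hm5⟩ : ∃ m t, m % 2 = 1 ∧ n = 3 * m + t ∧ t ≤ m ∧ 5 ≤ m :=
        ⟨2 * ((n - 3) / 6) + 1, n - 3 * (2 * ((n - 3) / 6) + 1), by omega, by omega, by omega,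
          by omega⟩
      have : NeZero m := ⟨by omega⟩
      have h2 : IsUnit (2 : ZMod m) := by
        have : IsUnit ((2 : ℕ) : ZMod m) := by
          rw [ZMod.isUnit_iff_coprime]
          exact (Nat.coprime_two_left).2 (Nat.odd_iff.2 hm)
        exact_mod_cast this
      have := existsRigid_of_ring (R := ZMod m) (w := w) (t := t) h2 (by norm_num)
        (by rw [ZMod.card]; exact ht) (by rw [ZMod.card]; exact ih m (by omega) (by omega))
        (hex _ (by omega))
      rwa [ZMod.card] at this

end ColoredSteiner

/-! ### Explicit base systems, verified by kernel evaluation. -/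

namespace ColoredSteiner

/-- The blocks of a rigid system of order 25. -/
def blocks25 : ℕ :=
  0x2c549172648c152260a0f24447982e38b961a4480d28446132030b0f184870c28485961c2c98d165080a2a3c50e1a28b8b1454809263c4941c24c0d12305892c504101c2090d10606082a2c4131420b910e48807263838f1a1cc0a0e584872e54316261888e0c34606202c3091018b100a5c7852a382941a1488a0a48485181c2980c14c1608549842e4020f16105090844404281c2120c10a940660983203c197180c88b06485030e181880a0c684066090226441151808b0a045c4821e2010b0e08a0604142021c0c1172804b11023c7012a3409816044070228301261408c08044830240101284c018200060a00444802e200150e00786002c2801c1001606006820048080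

theorem checkRigidSystem_blocks25 : checkRigidSystem 1 4 blocks25 = true := by
  decide +kernel

/-- The blocks of a rigid system of order 27. -/
def blocks27 : ℕ :=
  0x54a13344c8952444c94206498f30407982c38b901c5078e34586992a34b941a4878d34606132430a11185480c3454598242c98e164068b2e585182628890146870a32305193024b9112488092c3048f1624a8a1268c882c54417242088f103868828244182a1cb930e649072c3c3911c1c60b0e50507342439a2818b100c4c6862e2c30f14187090c60406325c2982214a8f0a487052c2c28d14148080a30305345c216221068c08645842428213121040708543042814216260ca12065c7833034191160c6080640383321819a0a0c7040660b822c501192208d0f043860216281131008687044830212141100808a83045ca812c4809a2004c8e02446811e300941604508021c301261409808044830264b00305001a240099000547002e3000d120058800443000e1400f08005030008080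

theorem checkRigidSystem_blocks27 : checkRigidSystem 3 4 blocks27 = true := by
  decide +kernel

/-- The blocks of a rigid system of order 31. -/
def blocks31 : ℕ :=
  0x1e3a64e9a3070d973464b9e305ce1a2c6cc963a6ca9e2c54e9c2860b142e54a1e384cd982668a93325099e3448c982474b92385491b2848b13246cd1138648972c44c152278a113a4c89e3640e182074b10325481a2840b9320488903a3c71c1e34a0e1a6878c30386161a30d8f165470b2e34591182cb8f144870a3634519182898b144c789223849e1a24a0c126058920284951e20d8e10406883c3041c1620a0a10744882c3c3901c1c90d0e70607322c39e141cd890e4c407323c3171c1898d0c40606242c3181418b090c684062a1c31e1e14c8e0a6868524302901614a8a0a5c4852c202910e14e860a6078434382151a10e8c085858422282191210b880850384361821c0a1088f06787033234193180ce8b06705033424192100cb8706503033014190080ca0f04707023a341171808f0b045850224241181008d07044430236141130808a8304407812c380981a04a8c0250581342809c120488802743813c180930a04904026c18132080921e0098e0044680363001a1600e8a005448032200180e00e0600502803c100160600802005c080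

theorem checkRigidSystem_blocks31 : checkRigidSystem 1 5 blocks31 = true := by
  decide +kernel

/-- The blocks of a rigid system of order 33. -/
def blocks33 : ℕ :=
  0x407cd9f3868f1d3270d994068c9e3860e9b307ce974060b9f3c58d182c64b964078a9d3454e172a6cb154070a1b3450f992878b943a58a182a50e9c2678d93326099a2e4d016267ca93407491e3448f98246cb9238589192a48a13244c8903044799203cb901c7878e3c4469b2034b0e1a8088c2c406171e30e8e185468c2a4459f202ca0f166c70b403459e182ca90147078a223851d1a28d0c145c58a28444922024c0e123c689383049a1624f0a1258888404041a1e2098e107c68830304191420e8910748872a3c3991c1cb8d0e486072c2c394141cf890e6c407364431e2018e8f0c687063834312161898a0c804862e203180e189110a50805363c2951c14d0d0a645853e282971214e080a4c38518182992210c10084c78438382141a10f8c08485042c2420b1010d070854304401421c220cf8f06807032634194180cc0b066c5033224192100c80706583033a1419e080cf910474802403c1121c08c8d046c602262c1161408a890478402381c1140c08c05045c202340c1172204d1002487813e380981a0498c0270581402809b1204a08027838132180960a04e840254181344401c2000b0f005070024340191800e8b006050026240151001007007c3003c1401b0800b830008080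

theorem checkRigidSystem_blocks33 : checkRigidSystem 3 5 blocks33 = true := by
  decide +kernel

/-- The blocks of a rigid system of order 37. -/
def blocks37 : ℕ :=
  0x12233e8d01e4484ea03e7521e3a8901c427ce23426d21c368d11a3c70d1d36692223284f19406cc9f3465220307cf184674c22366109a3070c984280ba23e5ce9c2e78d974868ba3325d2212c88f164670b1f365901a2c74c96305cb1c284ca932460a912c4c8942444d142080990484881722410151e90a0f3e4079d2a38f931c7890e423c71e2a34b141a8c90d324469b203498f1a5c70d2e506222631012185480c323c6111c30b15166ca0b3a4859f222cd0f166470b44345a1182d0951474a0a2e4c5162428d11148878a203851f182920b147ca89425049d2625112127888932404971e2500e1260689463049c14251951064a08344c41c2420d9110888083c3c4181c2100d107460816244192a1d1940e84987304839c221cd8f0e587073a343a4181c80b0e7850734243952818d930c5c90638403111e1918e0c906862c3031e1618c0a0c844063e1c3172a14c140a6c905484429d201518f0a707053e3429a181498b0a805052c202a20e144860a6ca844050224261109208888843c402181e10d0e0834604382c2231410b09082038432182222a0cf14066498334481a3220cc100674783363819c180cb8b063450348201a00c0d085067c2033454122280919304848822c401121e0920e047068236301181608c8a047c402401c11d0c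08f05045c202120c11c2a04f940260981324809d2205190025878144380a11a04f0c028058136280a41204b8802683010a10087060521500789803e4802022010900070780283801a1a00c0c008c580362400a1000b870088300321401d0800b030008080

theorem checkRigidSystem_blocks37 : checkRigidSystem 1 6 blocks37 = true := by
  decide +kernel

/-- The blocks of a rigid system of order 39. -/
def blocks39 : ℕ :=
  0x264a852a2409119f4484fa6407d2223c8d09e4a8cea63c752a43880f1c3e74e26486d1a03688e9b4270da644690a03494f9a4874d233868f1b348d1194884c9f3c6501d3298e194a6cca646612203094f184274c223860f9b3068c984458aa62c50e95285cb1348549a5284d017247cb12385c8a22844a922294b9036548222440991206cb0f2e547a3283ce131e6490f30447992c38f151c90a0e464c7212438f911c7480e343c7192e34e151a6c98d3a4869622353101a7878d425c6262a30c13185090c3c44616203100e189068c365c59a2c2ce14168098b4648599202d20f166070b3e345a5182d1971474b0a325451b2428d11146080a3e3c5251c28a0d1490b0940544972824f931274889203c4a61c24d0c128458944284982e20d151084a084c4c4242420d911078808403c4251a20e8c102c508382441d2e1cc160e64a07344c39e241d1900e846871e30391161d30a0e94487442039e2e192960c60a06424c31c24190110c7c806443c30e1a1930b0c3050632243231018a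870c7cb8540582a32a14f140a68905484429c201508f0a8868536302931414c090a644051c1c29d0c151170860a84345021e26112920898884484021c1c1118d087c6043a2c2211410d890858404401c21a2e0cf16067ca8340501a2260d312068c88342401a51e0cd8e0664603382818d120d207062c2830c101a42e09096046498230481252208a100498782443811a1a0918c0454582402811e1208f88047038236181050808e830498b8146580a12a04f940274981324409a200500d0270601442c09e14049090238401361c0a40c05285023c201300c09c2c01295006ca002648021220101000747802e380181a0110c007858048280231200f8700683004c1401908004030008080

theorem checkRigidSystem_blocks39 : checkRigidSystem 3 6 blocks39 = true := by
  decide +kernel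

/-- The blocks of a rigid system of order 43. -/
def blocks43 : ℕ :=
  0x9d32450991a94a8942542a522154890a84e81523409911f5280faa52792a43ca111e467cf2a4e751a23a8501d4a7cea63c754a638a121c4e84e2540713a5369119b4c80daa3e6d11c36a539a4a8cd26426941f3490e9a5470d1e366952832a51994e88ca43e6501e3274e19426ccaa4c613a33091018427cc293a60f1c30a0d984468c2532613252ea92174684ba2405d39e2ea0e973e70ba9365cd192ea54165494b24445939f2c84f164670b1d365901a2c98c96305cb202a50e152698a1346549172848c932498a913e508a526452122294a902c508182640e12208889050547a7283d2131e9490f3a447a1203cd151ca8a0e444c7202438b111c5c80e363c7162a354941a7498d424869c22353901aa878d32386992a31094186c98c34486292231510189878c463861f1a30c151690a0b2c4c5aa242cc91169880b523c5a71c2d18d167860b365451d2829093145890a40445292028e0f149470a3c345281828d0b14a4a8946504aa2625412126c8893e4049a1e24f0e12606894430497162530a125ca883c504282621392108488836404231e20e0e1098688403041f162110a1074488485439c281cd130e8890746443a0201cf8f0e747072e34398181cd8b0e9c5074224399101d1150c68a063c4c31f24193910c908062e3c3291c1928d0c586063a2c31914190090c60406501c32a2a152940a809853a4829822151900a7878550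3829a1a1538c0a845852e2829912152080a9838536182a12a10c94088c98430482172210d1008887843e382241a10e0c08a05845428225121148808783844c182160a10e95066ca033e4c1a6240cf1106a08032c3c1981c0d10d065c603402c1a4140ce0906a84034a1c1a30c0d485069c2033c541182808b9304a49025444119200900f0490702503411d1808e0b047c5024e241251008b070484302441411b0808d03047ca8150500a72604f1202688813a400981e0508e026c6814a300a2160518a02904812c200a90e05506027028140100990605302029ca8044500292600d9200a08803c400191e0130e008068048300251600c0a0058480342002a0e00e06007c2803a100210601182005c080

theorem checkRigidSystem_blocks43 : checkRigidSystem 1 7 blocks43 = true := by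
  decide +kernel

/-- The blocks of a rigid system of order 45. -/
def blocks45 : ℕ :=
  0x14a84ca9425569d22a4e8d5a646b122354a512c4a8942442ad12158ad0274c8152440950a058a4fa5487d1a23e9d09f5080fab50795263ca519e4e88f294e753253aa111d5884ea43c755a9389d29c508ce2a427131f38b0f1c4074e2c546d5a536a521b4c84da2406cf9e368ce9b58a0d294a69322348d09a567cd203c6951d3490e1a4e6cd284e6562632951994888ca9406551f3284f195674c9c36655aa30b13984c90c2942611a03094f183e74c22386141b3068c983e5cb1d2e551162a70b943c58a2c2a513172668b134e54999284cd1724a0b12485092b2649517228cb1136548a528451132284911585c8262c4149420789902a488202240c971e9cb0f405479b283d2921e6888f48407982e390161ca8a8e504c72324393911c7080e423c7292e34c161a84a8d56506aa2434e911a6c80d263c6ac1c351971864a8c4e5061c2631312186088c504061d1e3120e187c68c3c5c59c2c2cc1516a8a0b524c59b242cc9116ac80b463c5a21c2d40d168060b405c51b2c29215148ca0a424c51e2429591149c80a543c51f1c2930d149460a42584a62a24e94126c98932484ac222551012707893c384a51a2510c126858952284ab2e20e96108ca883e50420262161210a088832404291e2128e10686883c3040b14213891094b8754583ab2a1cd1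40e8c98740483a1201cc0f0e98707483439b181d60b0e745073e243a2101d2960ca0a86425031f26191120c78886304032b1e1948e0c9c686343031d1618e0a0c5c48648203190e192170a64b053c542a82814e930aa49053e402ac1e1558e0a7068542302a5161510a0a6048554202910e153060aa0b844a542222811613089c90438442232010f0f087470440342161810f8b086050448242261011487086c304341421b2e0d596067ca83304c19c240d2110668803503c1941c0d10d06a46034c2c199140d00906844034e1c1ac0c0d18506a8203425c1292c08d150460a024a4c11d2408f9104888024c3c11b1c08c8d04a8602482c12c14091890470402501c1200c0938504ac2023c0c1222e056160270a814c500a42604c1202a48813a4009f1e04c8e028c68156300a71604d0a02a0481362009e0e05506028028142100a506053970090b0052540202801513007c9004c44025200110f00687003c3402c180108b00a050056240181000e07008c30036140190800e830008080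

theorem checkRigidSystem_blocks45 : checkRigidSystem 3 7 blocks45 = true := by
  decide +kernel

/-- The blocks of a rigid system of order 49. -/
def blocks49 : ℕ :=
  0x5ab152e58a57ab50b95a75ea93b0509d72d4cc14a658a12af4c9582f48ad5245ca12294a9182d46a54234e991ab4a8d62446bd6225ca912d4e895a644b55a154a50ac4c8582542a11215eb502b528162740b92a0548d030448122140c171f5ea4fad507d5253e9921f4688fa7427d82c3cb549e5498f274a797a33c9111e5c84f28407959f3cb159d60a8ea94e754263ab521d5c8cea544757a13a80f9d5eb8e30567152838b529c4e90e2944711a1389901c587ce1e3a7119b349cd994068ca0366161a30a0d174660b9e36596192c90c16385cb243254e182ab4b955c58aaa3650f9a2874c944c60a272e5119628bca94446c99d344d81926b4c13525c9a62c4d09526a0d924e6892e3048f17247cb124a5491c344511922a4c113e5c8ab2c44d9522c0a11464c8ac244529b20acd1046648283041117209cb103c54829284099220a4d8f4a6879c323d0971eb0a8f5c4c794243d0111eb480f426c72632398181c94b8e505871a2a396941c7c98e3a4872a22397901c7878e52686aa30357971a80b0d50546a52834f131a6490d4c446ab1e34e0e1a78d0c326061b2e315161888a8c585062b2431211188480c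3a3c6201c30f8d18bcd8b42685a8322ce9816a8b8b52545ab282d613169090b3e405a71e2d10e168c68b5a305ab362931a14a4c8a426051d2e297961470a0a404c52a242941114c080a483c52c1c2938d14b860a48684a5322559812b8b8944584a62a25094129c98940484ad222551012bc78936344a3182580b127c5095a6c43034217191090b884a584202a20a1310bc908424441c202118f109c70844344291820f0b1074488386c3ad321cf180eacb8760543ae281d2130e989074a443a0201d10f0ea470758343a7181cb0b0ea048714203ac361979a0ca8c86605831d2a190140ca098646483262018f8f0c907065c34325181888b0c88506522431810190870cb8d8556642af3014d160aa8a8544502a526156920a9c8853a402a61e1520d0ac0605382c29e14147090a7c405461c2970c1581b08bcc843e602202e10e96089ca845050222241089008a87845c382211a1098c08985845a2821c121158808683843c1822c0a10e9b06a8d0344601992e0d696068ca833c501ab260d49206bc8835c401a81e0d80d0698603402c1a5140d608067c38338181a10a0d2040698d825a6811f320981704a4b0256541242808e1304849023c441181e0880d04bc6025c2c123140960904a84023a1c1270c0940504942021c0c11f360511a0278c814e600ac2e0509602bc98138480ae220521002c0781563809d1a0540c02945812a280a6100550702b430152140a308044830280101486c02e34010990094c004c5c01f2a0151300c09003a4402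c2000b0f008c7005a3401c180058a0078480502002f0e015860080280521002706011020050080

theorem checkRigidSystem_blocks49 : checkRigidSystem 1 8 blocks49 = true := by
  decide +kernel

/-- The blocks of a rigid system of order 51 with a rigid subsystem of order 25. -/
def blocks51 : ℕ :=
  0xb159a5a9cd2a4c694a434c119a4a80d2e3e6979e3488e9a5070d3136698a932c94195c98caa48655a332bd1194e7ccad3c6529d3280e19426ccad56618a730a92985890c2e426192030a0f984678c303a6179c30a4d9860bcbae585d5a92ea93975a98ba8465d89f2e84f174874bb2385d01b2eb1496509cb264a599222cad0965e80b303e5989e2cb8e965470b2436598292a9d3155e90aad46557222a950955480aac3c5591d2ac4e15566cab25a5182c28bd4145c94a2944513a12880f944878a2a3a5159c288cd94305ca192a5192f26ad51362989a94a4d3a4268d11350809ac3e4d81e2674e135a6c99a2e4d8ae24b1392609892848494a324a911264849253e4959e2480e925a7092f5a4592b22c541160908a6424572022a4f9154788a73a4511c22b0d913458894264593120bd59054a0825484162220b50904c808233e4171e20a4e90606c81a32418ab1eb548f5ca07ac4c3d9241ea918f44847a7403d29e1ebce8f3e70799303c9921ec970e54a472b50398271cb520e628c72544390a01cbcf8e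4c7071d3638b131c5490e304471420397ae1ac960d5aa86ab4c352a31ac110d48846b1403539e1a7ce8d386c6962834c101a5478d5ab062e54314a618c528c4888630403109f18c8f0c4674627383141b185890c2e446101e30c8d18c578b60a85ae522d925169920b4e8c5a8442d59f1684e8b587059e362cb92165488b2c4059a1e2c70d16b938a5e94531482962314b510a608452b402931f14a0f0a527052a3628c16144880a283c51a1c28b8d145460a60ac4b254254a712a12895e8c4b144256211290f895a7449e382531b12649892848495202488f1268609302c4b2602162a10a5408569442e46217a110b5008447c4263c2189d109cd88325c4182a20990103c708243440b142172d0ec560760a03af4c1d3a50ec9187528039f3c1d59d0e84e07446c398241cc910e5c8072c3c393181ca0b0e3848734203b15a199290cbd386609432446194210cb100644783263a1971c0c7cd8634603172a18c920c44686182c3131418b090c5040660b42ae56156250a9910554842a4401591f0aa4f0550742a3381579b0a5cb0534542922214c8e0a4c685283028910145070a3c30562c022f521162808ad384649822d4a111a10889004547c224381171b0868a042a4c2171c10c0c0864584222820d1210b08081c30420142305c0d7aa06b540356901a6460d3a206c508340781ac3a0d29c06c8d833258198260c890065c783343418a120c60806543831c1818b0a0c9040684d0258641263009117048cb023e5413128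09713046c9024a4411c200980f0478702503412f180968b04c85024024124100950704ac3024e1411d080948304c8d0160640a2300529702b4b0150540a6280509302bc90146440a72004d8f02b070152340ab180500b02745015c2409c100520702a8301621409e0804f8302bd60062a80324e0142600b9200568802942011a000b4f803c74030380129b0058a80344800e180098b00645002e2401110006870040300301400f0800a030008080

/-- From order `51` on, the tables contain the rigid system of order `25`, and the search has to
color only the points outside it. -/
theorem checkRigidSystemFromSub_blocks51 :
    checkRigidSystemFromSub 3 8 blocks51 blocks25 = true := by
  decide +kernel

/-- The blocks of a rigid system of order 55 with a rigid subsystem of order 25. -/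
def blocks55 : ℕ :=
  0x3362b9b3558d16aa66c14b250952a344d9a2160ad0a84e7daa03eb931e568cf2d4c7149d38a911b6474daf4e6962434c52195e80cb46261b2f30d55185aa4c2b4a6192430b11984e80c2e3e6111e30cce985070c26366109a30c0c985eb4bb2565d7292ea13176a90bb4445d6212ea9017467cbb33c5d89d2ed8e174e6cbb0345d2992ec17166cb4b3458599a82c99296648cb2f44593a12cad016547cb243c59a9c2cc4d965268b1d3259ab32ab951562a0aa94e559262ad92954888aa342558202ad0f955874a9e385579b2ab4d155664ab36451a2f28c169458a8a2b50513a628c52945290a36465111f2878e944070a21365171a28d4c9464b09ad564da2926c53936a989aa4a4d72426bd19344849b33e4d41e2680e93606c99c344db1926d17125eb092a5249b2824c13126694924464992124acf92627892d3a4939c24d4d9240689223248b15245c99260bc8ae5045aa722b529154908b346453212289011627c8ac3c4559d22d0e11526c8b634459192260a916ccc8325c418aa20b14905aa082b4e417a620d51104a808213e4181e208ce9048708343440d9920b958f6ca47b44e3d6261ebd20f548c7b3443d8a11eb500f3e787b53a3d81c1e94d8f64687a8323cc141e4888f64c47355c397ab1cd140e6c9c7334c394a51cc118e5484724403911d1c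b0e0e5a6c71e3438f991c60b8e6cb86aa50358271ac530d66906a946356221ad100d5a7c6a53c3579d1ac8e0d566c6b534350991a5cb0d22406b55e318ad18c160c66ac6294c31a2518a120c4e8c62e44310a018d8f8c647862a3a30d9a1870c8c28446132030b0f184870c6ac05b1582da2b16a540b5e945a7482d6a316c910b5c805aa3c2d09d167ce0b6c6c5b3342d319165090b2c385931a2da3214c578a6ab452c5629b2414b918a60885334229320149cf0a3e7452a382941b1494d0a52645142028a8f143868a2e2c534662572d12c95095ea04b64c255a412d518962884a9422581f1280f094a704ac3624e9a129cc892a404931e24a0e1260689182c4b5622193010bd70866b042b522152610b52086c804253e2109e109ce884470423362141a10d0c882c504101c2090d10606082a2c41314219ad0ed95075ea43b44c1d8240ea11874e883a5421d8a00ec8f876a783ae3a1ce1b0eacd075864397221c9100e4c7071e34398141cb090ed988656a833552199270cc1286508832f42196200c98f8668783243a1999c0cb8d86466832d3218b950c58986223830d181880b0c244066cc02b35e1592d0ab13856a942b146153220a9108550802a93e15a1d0aace053c6c2aa34157190a588052e3c2951c14a0d0a44505242428c0e14c060ad590468c022e58118a908a9384569822d4411421088d0046c782253a1179c0890d843e6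82333210c1608549842e4020f16105090844404281c2120c116ac06c558364a41b0500d3a506d12034c8c1b5420d9a006bcf036c741ae380cf9b0688d035464195280cc1306407832e30191160c90a061c303101418d080db3204bd5026aa01334e097250499202688c12b44096a104b0f8252781303a0989c0480d823464118240899104546022c281171208788042c3822818105080870304d5a016cac0b0540562802b53814a900a9440572102c90015e7c0a63a0519c02ccd81626809e3204b9402588811e380951a04c0b022038114180930a04604022418120080b1600192f00d558066a802e4e0162500d910052800243e0169e00a0e804270034360131a008cc80284c018200060a00444802e200150e00786002c2801c1001606006820048080

theorem checkRigidSystemFromSub_blocks55 :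
    checkRigidSystemFromSub 1 9 blocks55 blocks25 = true := by
  decide +kernel

/-- The blocks of a rigid system of order 57 with a rigid subsystem of order 25. -/
def blocks57 : ℕ :=
  0x6acd83662b592e58d982968a94b55e9d6aa4cd972566ad2304c8dc3744c54a270990b5568192540a922068ccfb462796283cb911e6ea0ea7467529f3abd19c6e90dab386dc3334d571a68b0d2f5669b2a34dd49a649cd284c698a534b521a4278d223a68f9c348cd9a6ac8cb45e65c2b32dd3996290ca5466562232d90995280ca63e6569e32b8e995470cb33665c3630cd8985ea4c2b506172730a92986490c2d4461aa130c10184678c2c3a61b9c307cd986ec4bb35e5d92d2ea54176c98bac4a5dc242ead1975484ba2405d71f2e9cf176070b9d365db332cdd81662b0b2b52595282cb52965c8cb2f4459c202c84f964878b263a59a9c2cd0d9668c0ab8585592b2abd5156a98aa54855b232ac50955a80aa83e55b9e2acce954e70aa23655ab128bd71466b0a2d5051a2628d92146488a274251ba028e0f946078a2a3a5129c28a4d94305ca192a51b3426e171366b49b5524d5a726c931360949a8464d12126b1013487c9b13a4cf1c26a8d93345c9b35c49bad24bd6126aa8938524982824d13924888925424932024acf9264789363a4989c24d97916eac8b2544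582722b931158908b146452a222cd09150808b53e45a1d22a4e113c6c89a2c44a1322c97905aac82e5441aa520a1210708c8334441ba120d10104e7c8363c4149d20b0e10606c81a3241c321edd78f5cb47b0563d9a91eb130f4e947aa443d1a01ed8f8f6a787a13a3da1c1ea0d8f3260793243d8ae1cc168e68ac73850394a71cdd28e6a9072a46396211cd900e5e7c71e3a3931c1cc8d8e2c4c7152438c111c5080e70d06b16035baa1ab148d6ca06ad4e353221ab908d5e806a33e3559e1ac8e8d66706a53634b141a6080d2a3c6b86031bae18d568c56a8631503162718bd20c528c634443192118cd00c3e78636383131b185890c2e446101e30c8d18d5a0b6ec85b8622d6ac16c150b669c5a64a2d1a2169108b527c5a03c2d59d16a0e0b5e6c597242ca91165880b343c58e1a2dbb314c550a5ca45364e295a614e128a60905344629aa214a108a407c52f3a2991c14b4d8a30585122028a0f146870a2e345151829c3512dda095eb44b6582542712ad2894c904b2462582212a5089547c4a03a2571c12c4d89324c4942424a90124478934304981625bb510d190862bc430582172810e1388669842d46215a11088f8854784243a2101c10d8d88325c4182a20990103c708243440b14219310ed168758ac3af501dba60ea52874e903b5461db220ec10875c803b33c1ce9c0ee0d873048399221c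b900e587872630394161c7090e684076cc83385a198ab0cbd306689432e48199a30ca11064e803303e1949e0cd4e86427032c3618d180c5ca8632483111a1860b0c4c5062c2431410199300ad17056eb02b35415aa80a9d3055e942a948155a20a8d085627c2b83c1569d0a80d852e5829a2a149110a64705263429418144880a283851e182b85e1182e08d56046cac233501152708a5304689023746118a008c8f844a7822d381109b0868a042a4c2171c10c0c0864584222820d1210b08081c30420142366a0d9b206c178358a81ad520d8a706a1283488c1b4420db9f0698f0370741a2380d71b0664b03304c191200cb8f0668683142418c100ca8706383031614192080d7a104e0e024e6c13034094190498c02685c1322c0949504aca026e4c123240969104c4802483c1331c09a8d04746025c2c12c1408f0904944023e1c12a0c09b050488202400c13250056a102b0f8140680b03205a1802d4b814e580ae2a0519402bc98136480b8220531002c478144380a41a0528c02d85813c280b3120548802a83816e1809c0a04e8402ac1816ed802e5601c2a00c948068a00314c019a500b11804e88021400169f00bcf0060740243801a9b0058a80344800e180098b00645002e2401110006870040300301400f0800a030008080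

theorem checkRigidSystemFromSub_blocks57 :
    checkRigidSystemFromSub 3 9 blocks57 blocks25 = true := by
  decide +kernel

/-- The blocks of a rigid system of order 61 with a rigid subsystem of order 25. -/
def blocks61 : ℕ :=
  0x1d3966f1a3368c98bc74c1cb85ae98ad76e563766ade2a52edd285ca93b15e998aa4aad4a564c12365e91da948e13a466c11b75e8dca746b96224e951366a85c3242b92a150910b74485aad40d549f7698fa5467d1203ecd91e6ec0f3956795263cbd69d68acea74c75b203af1d9c6ac8e386271d2c38b919c78b8db44c6d42236b0f1b70c0d2d5669b2a34d101a5074d376c65aaf32a54195880c9f3665db830d599862c0c3c5e61d2e30e5418689cc294c61ba430ad1185884c23406169f3094f186c70c1d366191a30a8c9878d4bb8685d8ae2ec15176ca4bac505d6a72ee53176494bba465d7a12ecd0177678bb73a5cf9c2e90d974468bab325ddb22cd57166eb0b3656596aa2cbd416789cb264a59ca42cc51966688b384059a1e2c7ce966070b3a365949a2c84c9676d8ab968559b12ac979570a4aae5055d272ab13155a94aa446555a12add015607caa23c5551d2ad4d957868a9c3255b3328dd91468bca2d5851dab28d551474a4a2e4c51e2428a11946288a213e5139e2894e944070a303651c9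a28e0c9474d49bc624ddae26dd4935aa09ab4e4d62526d12134c8c9b8444d7a026d8f9342789b03a4dc9c26a8d9366689b2324dc3624dd71258ac933524992724e9292629092a4649ca2249909278809343e4941e24d4e925a7093b364979a24c0c922c549172649ab422ed81164b88b35845c2b22e55116ea08bc4c456a322d91114e848a54045d1f2290e9152708af3644f1a22c4c9130548bb6e41c2f20c169062b082b5441aa820a53907894834464132220cd09064808243e41b1e20e8e90386c82e3441c9920e5a8f6ec47b35e3db2e1ec968f54a07ac4e3dc261ec128f56907b4443de1f1ea4f0f76747a1383d01b1e8cd0f7464798283c9111ef1c8e76cc73a6439ab01cb150e5aa47385039b271cdd28e4c9072f44398a01cacf8e46787213a39a1c1c6cd0e5c647182e39b311aed78d60b86b458354271aad30d72946b348354a31ac910d54846ba4035c1f1ab4f0d3a706b73635a9a1af0c8d2e586912035cb218d170c76b462f543182918c540c6c9863a483162318f110c42806373e31a9e18cce8c5670638363139a1894c8c28446132030b0f184870c74e05bc642d82f16d968b62ac5b4522d9a716dd30b6a945a3442dda116a900b587c5a43c2d71d16a0e0b726c59a322ca12165870b26345b96c29c2e14dd68a60ac53a54299a814ed28a648c5354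429a21149900a5e7c53c3c2949d1490e0a626c52c3429399145080a2a3c50e1a28b8b14e9a0972b84b55825e2b12c95095e9c4b04c25b2512b510952844a4402541f12c4f0970744b7382519b12ecd096664495202498f1250709303448c1625caf10f168860b042e5621daa10c548868a04334c21aa410e91084684427402191f10e0f084a704363621b9a1074c882c504101c2090d10606082a2c4131421c370eed8875eb83b35a1d92c0ed15076ca03a5481daa30ec110778843a9401dc9f0e78e874e703ab361dd1a0e98c872e44392201c98e0e3c6873028396121dcb70ce1a865cb43365819d2b0cc538664983284a19da30c91106608032a3e1979e0cf0e866670329361909a0cd0c862e54316261888e0c34606202c3091019bb40ad58856cc02b25615c2a0ab9485769c2ba4c157a50ab1205788c2ad42154200ae4e8544702b33614f9a0a78c852c402971e14a8e0a50685222829212146070a6030578d82376a11db408e588474bc22c521192808c1384709422e481152208ad004667c2233a10f1c0884d844c6822d3210c1608549842e4020f16105090844404281c2120c11e3806eda8368c01af520d5a806dd3835a981b34a0db2306e908372801b13e0d71e06b0e8354701b2360d21a0688c832a50198260c80f065c603222c192140c38606202831a101ba6e09c3304d990278b012f5609ca904d538250981344a0952404ed102608412e3e0901e04c4e825a6c1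1c3409199046090226441151808b0a045c4821e2010b0e08a0604142021c0c13c6e05b3402e160166a80b2520582802d53015a900ab4605ca102b90014e7c0ba3c0511d02bce014a6c0b13405d99025ca012c4408f1c04a8d0260581101c08a0c049850230201120c0900405d3600e580066b80345a017ac00d55806ea803c5001c2300a5100628403b4000f9e00c8e804c70027360129a0090c80284c018200060a00444802e200150e00786002c2801c1001606006820048080

theorem checkRigidSystemFromSub_blocks61 :
    checkRigidSystemFromSub 1 10 blocks61 blocks25 = true := by
  decide +kernel

/-- The blocks of a rigid system of order 63 with a rigid subsystem of order 25. -/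
def blocks63 : ℕ :=
  0x3c74d9ebc68f1ab278c17ba70b98b05cf9b2d7ce96386eb1dad58e99ab64b95bc5aaddb652e1a2960b14b76ca172a50e5ba764b13b55699d294ca93a668cd2b55e9582a4af94a570c523056918a846f1ca268c112f568962344f5ba176a90af4685b3340f98a06a9d03b4481db73ee571f7a8cfb3427dc2f3ce541e6484f2d407921f3cd599d6298ea84a756a13af9e9c62bce37487191f38b8e9c72d0daa526d6a6369d19b6474dbb7469c3634e5a9a6ec4d325a69f2834d131a7a94d2f48699a234f109a5c80d293e6919e349ce9a5870d303669db832d58996ebccb45a65f2b32e951966a0cbc4e65b2532a51994888cb0426592032b0f995c78cbd3a65c9c32d9a987accc326061f2f30d151878a4c3a5061da630dd2985c90c2242611a030b4f985878c393a6139c30c4d987cf0bbd705dd342ec169762acbaf545daa82ecd3977298bb24a5d2232ed90976e80ba23e5cf1d2eece17586cbbe7659a322ccd8167abcb315859caa2cd5496749cb284c592a42cad1966c88b383e59b9e2c80e964270b2e3659bb42ae19957cc8abd60555aa2ac53955e98aac4855b232ab91157484aa9405529f2ad4f157674aad385541b2af9c947ac8a3b60519ad28d161470a8a37525172628c5294788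ca2844512212880f944e78a363a5159c28d4d94305ca192a51eb926f9a936cd09ba5a4d62b26f15136e989bb4a4d3a426e11935c849a8404d79f26c4f1352749b3384d11b2668b937ae893b7249c3524f99926ec09345c497a924ad392649092a46496a224c50924c809283e49e1d24d8e124a6c93a6a45db422f589172bc8ac54455a822a53915c948be48456a322c911170848b04045e1e227ce914c708b63644d1622509917ad883e6841e3320dd91074bc83b5c418aa20b14104c9483948414a2209d09056808303e41c1d20d4e103c6c81a3241cb21ed188f7ab07b7563d6a91ee140f5e9c7b34c3de251ed520f608c7ba443d5201ed8f8f7c7479e383dd9b1e64c0f26487b76a39b321cbd70e72b473c58394a81ce138e609872b4a399a41cd118e628873d4039d1f1cf8f0e54747213638b131c5490e30447142039d391ad570d6eb46bb56359aa1ac548d60a06be4c353a51af520d648c6b84435a211ad8f0d5e746a03835e1b1a58a0d30406951e35e3b18e5c0c6ecc63a6231f3018c978c5cb46344e3162618d518c7a88625423151f18acf0c4874628383101b185890c2e446101e30c8d18e9b8b76cc5bd5c2d7ad16e158b64a85b9522da2816d938b4c905ac422de2016c4f8b60785a23a2d19c16f8d8b2e48595222cb10166878b1c345bc6e29db514e5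98a70c85345e298ad14b948a609c52c4a29b2414f918a56845263e2911e14e8e8a547053d3628c16144880a283c51a1c28b8d145460a76c84b66225e2e12cd60972ac4bd5025f2712b528952904aa442532112bd0096a7c4b43c2519d12e8e09706c4992624a121254809223c49a1824c0b12cd90876c44366021f2e10e56087aac42d54217a810e128878904374621aa210a508874804263c21a1d1070d88325c4182a20990103c708243440b1421ebb0ef9b876ad03b3621dd300ed950756a43b2501dc260eb52075c8c3a7441dca10eb10074a783bc381cf9b0e609073244397201cb0f0e4c607282c38e121cd080ef188666bc3375c19b2c0cd55065aa033d4e199260ce928676903394619c200cd0f8652783303a1911c0cacd8634603172a18c920c44686182c3131418b090c5040674c82b86015b2f0ad56855cb02b45615ea90aed40578982b34615f210ae50054e7c2aa3c15b9d0a94e05486c2972c14d150a4888532382931a14a0c0a24405141c28f0c15e3808e580476bc2365c11aac08f55045a9c2344811d23089910450842254011f1f08ccf0456742293811b9b0868a042a4c2171c10c0c0864584222820d1210b08081c3042014232620dc2d06bd6037ca81b3520de2806b93836c981b94a0dda306dd1036a841a4400d59f06f4f0360701ba360cc96066098322401971e0cd0d062848318201950e0c706062c28324101b96c09eb504a9202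688013b3c0999b04acd024c64138300971704b4b02785413a280991304b09026e44123200908f04707023e34129180928b04a05026024127100978704f830244141310808e8304a13817a980ba48052a302f910170700aa3404d9902acc01525c0bc2c05c9502bca01604c09e240599102b48015c3c0bb1c0560d02d86016a2c0a01405b89027c4013a1c0a10c0588502c8201680c0be7001cb100d580066b803d5a01b2b00dd50064a403b4e0142400991804a880214001e1f00e8f005874034380179b0058a80344800e180098b00645002e2401110006870040300301400f0800a030008080

theorem checkRigidSystemFromSub_blocks63 :
    checkRigidSystemFromSub 3 10 blocks63 blocks25 = true := by
  decide +kernel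

/-- The blocks of a rigid system of order 67 with a rigid subsystem of order 25. -/
def blocks67 : ℕ :=
  0xf9eba78e9cc06ad1db46509b317ec583566be1325ee5bae78d973f76b5eb75b0182d6ed563a64b1fb956e1a2b84cd5be62ae03f54f572a82b553b58a9fba52f59295eb94c274a20b850f9aa872cd42f56a1fb84eed7a76cb13b97099f364d058a684f12bf6e95eac4ad942582d52405c920c046e9a23609d1c17a899ad44e162276a11304a893a444f1da16cc90ba5a8572b42e15217c9d0b34685f3340e52206c8d0264281bb33eb969f84a8fb1527de273ef531f6494fb4487dcb43d0581e70bcf355279da33d05c9d76dceb45e7582a3b0931d7a80ec07c71c3238f189c6aace2e4e71824389911c7eb0da94c6da2536c521b6480dc03c6de1d370159a66a4d3750697a5350921a5a8cd22406961e34dd81978a8cbe46658a032e8f196a74ca93865b1b3305f1878d0c40626182e30d56985eb0c385261da630e92987a90c3f4661b2230a10984e80c393e61b9e30cce985470c2b366191a3108c9876e4bbd705e0b72efd99780c8bb15c5db2a2ec1497689cbbc4c5d6a42f091976a88baf425d4202eacf977c78bba3a5d61c2e6cd174a64bb96c5a0b42cf19967ac0b375e59dae2cc959658a0b2d4e5a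0262ca9296628cb224259d202ce0f968478b293a59f9c2cf8d966a68b24325a1372b05b1566c8ab96255db02af979570b4aba5655e292af54156a9caac48560222a950955480abf3e5531e2a8ce155c6ca9d3455a192b05d1484e0a3c6a5193028f971480b0a2a52518a828dd3145694a364851ca328d11147a84a2d405179f28ccf147e74a273650e1a28ecc9484fc9bc6e4dc3526d19937abc9b25c4db2d26f961376ac9b0504dca726952134c8c9a9444e0212704f9354789b13a4d01c26e8d9334649c17649fb424e999278bc9425c49b2b24b54927a9c9324c49f2424e11927288931424982024a0f924a7892c3a49b9c24d4d9254689403248b15245c99285048bf7c45c3622f5a9178c08ba5c457ad22cd611549c8a64a4592422ad19162888a94245ba022ecf91807489e3845c9b22d0d1150648982a45fbd2109c907ce083a6c41ab120f169082b0840524192820dd390669482b48411a220c1090688082e3c40f9d20bce10546c83b344131920e9c0f6ed87bb663deb11ef980f7eb87bc583e1291ee528f4c907b2463d5221ed508f5e807c03e3d59e1e9ce8f68707a8363e09a1eb4c8f3050792223debb1d09a8e6ed073c64399b01cc578e72b472c563a0281c9d30e7c9472948395231d0508e5c8073a3e39b1e1c74e0e706c73f34391191c60b8e80f06bd7235c3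11ad180d82bc6b35c356ab1af950d6ea46ba4e35da51ad518d64886ac4035b1f1a90f0d50746c2383509b1a98d0d7e646972c348901b09f0c80dc63b6a320b218d188c70c06395e316ac18f158c549862e4a3142418a518c748863f403109f1878e8c667063d3631b1a189cc8c28446132030b0f184870c82fc5be722e03816e9b8b6cc05b1582deab16cd50b68a45b24e2d6a616bd20b4a8c5c2402da9f16f0f0b44745a8382dd9b16b8d0b4264594242cb0e164c68b7ef053e7629d351509a0a6ec85405e298aa14b148a5aa052b4c299a414f518a7284525402981f149cf0a5c74536382911b14e0d0a82645142028a8f143868a2e2c5427a25cb512e98896cbc4be5a2582c12ad509829c4b34c2602512ed209508c4bf4425a2112a500964784b83a24f9c12dcd8978684ae3224a90124c78928384981a2460b12fda886ccc43b6221c2e10e56086eac4325421e2810a538868984414a21f22110908880804233e2169e1090e88747042f362181a10f4c882c504101c2090d10606082a2c4131421dba0f01c877ed83b5641d9b10f0570784b43b4541d5a70ea130752943bc481dba30ee1007587c3a23c1df1d0e84e07606c3bd341d7990e5c88724403931c1c78d0e605072c243c2801a0bc0cf9a067ec8337621982b0ce950676a43284e196260cb5286709032f46197220cd50067a783363a1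9c9c0c7cd8642683333218b950c58986223830d181880b0c244067cf02c07415db60b0598564c42b560157aa0aad48568a02c24e157260ae12856e882a4421501f0afcf055a742bd381519b0ae4d0558642962014b8f0a54705283429114149090a3038530182bd7811db808d9a047cc82426011aae090548454a02404e11d2608fd204588c22f4411ba108ad0043e782253a1169c08ccd8462682393210c1608549842e4020f16105090844404281c2120c1203d0709d836cd41b8660d82f06d170364b41b7540dca906c53837e981ba480d62106f1003447c1a83c0d19d0694e03826c1be340d5990654a03304c1901e0cb8c064458324281870c0c405063420380ec13c7009f3704f5a0272c813f5e0a12c04d55026ca412e50099a704c1302629412446095a20480f024274141380969b04e8d023e64118240899104546022c281171208788042c382281810508087030501b017acc0ba6005a2d02b960182ac0b954054a802bd3016a940b74805e2303091017e840bb4005f1f02c4f01647409c360539a02e0c812e50096220478e0254681302c0880e04506024c2811810089060480202e1b807ad80406601cb000e978062b40345801f2900fd4006a980274a0152400b91807888041400109e00ace8076700423600f9a00c8c80284c018200060a00444802e200150e00786002c2801c1001606006820048080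

theorem checkRigidSystemFromSub_blocks67 :
    checkRigidSystemFromSub 1 11 blocks67 blocks25 = true := by
  decide +kernel

/-- The blocks of a rigid system of order 69 with a rigid subsystem of order 25. -/
def blocks69 : ℕ :=
  0x21c07701f3a7ef5d4078e5fbb730df3884f5b3e72d9eb868edc337ed59b568ca13a6301fb078c58406ebdcb25f0de2e7edd73d60b9f305ad572d6ccd63262b223a56e5bab6cd15bc64ade3754e99aa70c154364a5b3053056a988ed43360a1eaf50e572886b54416c9d6ac4f0daa67ac53425e995a94ce1aa55eb92ac5095fa74ab152470a52314a91fbe4709e2382d11bd588e02646cd22382f913f788a1374511a2270c513b5289d3642c572184ad0bb54859a54305ba080d50325a817aa40e13a072990447a7e0363edd61f54a0fa7487d4a33f09d9e66c4f3a4e795a53cc921e8880f213e7a2373ae5a9d78bcebf5a7612c3aa131d7488eb2427619f3af989c82ace4452721a738b529c8490e2e4071a1e3911e1b7cd4db9686e0b336f551b769cdb24c6e0213688f1b76e8d3e686a23334dd91a82c4d385c69e2d34c161a84a8d3f52695a8350129a5e90d264469ca1350d01a6a7cd233c68e9c34d8d9a82f4cc36c65bb332e991968c0cbf5665caa3301499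78a0cae4e6562632ed2995e8ccb5446522132f9019707ccad3c6589d3270d9986f4c3c7661fb83109a9882bcc3e58619ab30d151874a0c314e6172630e5298648cc30446222130910185a7cc373c6201c30a4d9884fcbb9705de362ee9a1766bcbc45c5e02b2f055177aa4bb24e5d6a42ea11978688bac425d8202e98f976a78ba53a5dd9c2ec4d978900b4260598af2d057167ab4b3e565a1aa2cdd496669cb384c59ca42ce91966c88b284259a202cfcf967878b3b3a5961c2c94d9686e4ac47055e342b0591580c4ab65c55d2d2abd6157aacabf50554a72ac13156e94abb4855aa32acd015847cabe3c5551d2a84e1588fca3a6a52133290191476c0a365e51a2e28e549482a0a3c4e51ba628f52947c90a4346516a12889014627ca2a3c5159d28b0d94305ca192a51ab126e581368b49c4584d72a26e949370a09c24e4e0a626d929386909ab464d9a226f109376809be3e4df9e26f4e935e709b7364cd17270a0927ae49446c49f3224d581270bc93a5c49e2c250151262a09374e49fa624ad212768c93442494a02494f9286789223848e9b24e9c116ed48bc6645b3222d189160bc8bb5c45cad22fd61186ac8aa5245f27229929188908bd44450a02304f11807489f384519b2268b11284c8be7a41c3720fdb1082d48406641d2f21097105aa882c5241427211131078908314641922210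d0904a8083b3e4181e20d0e90727081a32421bf1f05c0f74dc7b4663e2321eed68f62ac7af523e1281ed538f54987b04a3e0241e8d10f7a847ae3e3d61e1ef8e8f6c707a0363cc981e4c90f870873e6e39db41ce598e88c47325c397ad1d0160e6aa072a4e39b261ce928e7e9072b44398211cf500e827c7293c3919c1ce0d8e2c4c7152438c111c5080e85006c47c35ebc1b0580d66b46ae5835dab1ac550d6aa46b94e35a261ac928d50906b746351211abcf8d6c786a03a35c1c1b0cd8d2c506982034a8f1b05f8c84e06366a31cb118dd80c7cbc6335c3192a190140c689463a483222318b510c528462c4031e1f1898f0c4e7463d383159b185890c2e446101e30c8d1909f0b82e85c4722deb716edb0b7ec85c3622dc2d16d160b66a45a74c2daa416a918b80885af422de2016acf8b3c745a8382d81b165c90b2a44596202cd0f163868b78e85376c2a2351509a0a86c05405a2a0ac14e158a7ea853e5029da614a528a5c8c52f44293a114c500a7a785333a2991c1490d8a30585122028a0f146870a2e34515182a0b9130da0984c84ba602622f12ed60956a84ae5225ea712f13097c944b748256a312e10897e804a23e2601e12d8e896a704a83624c9312509092a404911e24d0c12605897aec4427221bb1111180868bc4435821f2a10f148866984414a21b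24109d188508843542215a010c8f88707842e3a21d1c10b4d88325c4182a20990103c708243440b14220bc0f01c0776dc3bd6a1e1b30ef97076cb43af561d9280ed138774983c44a1d8240eb11077e843a03e1dc9e0e8ce8754703c2361cc120e648872e403961e1c98c0e505871c2439a101e03d0d05d8674e433c6a199b20cc568670b0330561a22a0cdd4067c983434a197240cd91864e883424019a1f0ca4e867e7032f3618d180c5ca8632483111a1860b0c4c5062c24314101a1c10af1c057ccc2bb62159300b0170572b02b55615b2a0b0948568a02c44e156a60a9510546842ba3e1579e0a90e856e702bf3614b960a68a8524442991c1498d0a50605122028a0e147860b12184830023e7611fb408f59046cc42355e1212d08b158452a02304e11e2508e518448882374211d2008b8f0470742333810f9b0868a042a4c2171c10c0c0864584222820d1210b08081c3042014244840df3c070dd0376d41b7680dc3206fd7835aac1b1520db28070138354941bd480dca2069908346801b33e0e09d06c0e035c6c1992c0cc1306448032e3c19a1a0c50906304032a1c18e0c0c585064820370d81435e09aaa04d14828290130460972204f90825080127340a2190474c026e5c1322c08d950470a02804c12d240a11104ac802723c13c1c09d0d04ec6024a2c11f140998904fc402621c11e0c09e850498202580c1448205daf02dd68174b00ab4e05a2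40295181607c0a63805e9a0308c816c600be2e05a960288a8170500b2260599202a088136400bc1e04e8e02fc68186300ae1605c8a02c448180200a90e050860280281541009e06061b70101a007acc03b6401fb101116806ab002e5601f2900bd38084940264801c2300a910082840364001c9f00a0f00607403c3801d1b0058a80344800e180098b00645002e2401110006870040300301400f0800a030008080

theorem checkRigidSystemFromSub_blocks69 :
    checkRigidSystemFromSub 3 11 blocks69 blocks25 = true := by
  decide +kernel

/-- The orders below `25` are needed only to fill a truncated group, so no rigidity is checked for
them. -/
theorem exists_order7 : Exists 1 1 :=
  exists_of_check (data :=
    0x608082830418281080c08508003030008080)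
    (.inl rfl) (by decide +kernel)

theorem exists_order13 : Exists 1 2 :=
  exists_of_check (data :=
    0x609102c487182c30a0e144060a2c504181c2080e0c5060630283121018a10084850418202160c10c140458802243010a100870404509001c30016140080800602000c080)
    (.inl rfl) (by decide +kernel)

theorem exists_order19 : Exists 1 3 :=
  exists_of_check (data :=
    0x4888f1c345901c2878d1448809223848c142478e10305881a244101e1c88b0e28407203431216188880c30386223028b12149080a3c305243820d181080b08445041e242070a1090d0640603121c18a0c0c70506202031c3010f160890a043438212181100a088830444801243008b140470702342810c1008f060440202446801e3001010009070038300141400b06002020024080)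
    (.inl rfl) (by decide +kernel)

theorem exists_order3 : Exists 3 0 :=
  exists_of_check (data :=
    0x8080)
    (.inr rfl) (by decide +kernel)

theorem exists_order9 : Exists 3 1 :=
  exists_of_check (data :=
    0x10142070c0c305041c202100c1080e04304021418110180070a002030008080)
    (.inr rfl) (by decide +kernel)

theorem exists_order15 : Exists 3 2 :=
  exists_of_check (data :=
    0xe162468a1238687182c38c10185070c34605101c28b0c1470a082c404121820c140c48806382831a1018b140860904344021c18105080838304345811c200890e0450502302010c0c08e18005080034300121400708005830008080)
    (.inr rfl) (by decide +kernel)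

theorem exists_order21 : Exists 3 3 :=
  exists_of_check (data :=
    0xa111e5098e26446901c34990164870b2230592222868c1450809243448e1824a12103c6081a2c412181c58a0e3c487262038f1c18a0b0c4c48614203100e1890f0a4050522242940e146060a4c784203020a121070808443841a14213240ca0d063c50320201910c0c705062c203224010f160870a04244021a1c1120c089850450202180c1101e0498c0250501222008e0e04686022c2812410089060491000447001e34014180098a002c480101400608003830008080)
    (.inr rfl) (by decide +kernel)

theorem exists_order1 : Exists 1 0 :=
  exists_of_check (data := 0) (.inl rfl) (by decide +kernel)

theorem existsRigid_one (n : ℕ) (hn : 4 ≤ n) : ExistsRigid 1 n := by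
  refine existsRigid_of_small (fun n hn => ?_) (fun n h4 hn => ?_) n hn
  · interval_cases n
    · exact exists_order1
    · exact exists_order7
    · exact exists_order13
    · exact exists_order19
  · interval_cases n
    · exact existsRigid_of_check (.inl rfl) checkRigidSystem_blocks25
    · exact existsRigid_of_check (.inl rfl) checkRigidSystem_blocks31
    · exact existsRigid_of_check (.inl rfl) checkRigidSystem_blocks37
    · exact existsRigid_of_check (.inl rfl) checkRigidSystem_blocks43
    · exact existsRigid_of_check (.inl rfl) checkRigidSystem_blocks49
    · exact existsRigid_of_checkFromSub (.inl rfl) checkRigidSystem_blocks25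
        checkRigidSystemFromSub_blocks55
    · exact existsRigid_of_checkFromSub (.inl rfl) checkRigidSystem_blocks25
        checkRigidSystemFromSub_blocks61
    · exact existsRigid_of_checkFromSub (.inl rfl) checkRigidSystem_blocks25
        checkRigidSystemFromSub_blocks67

theorem existsRigid_three (n : ℕ) (hn : 4 ≤ n) : ExistsRigid 3 n := by
  refine existsRigid_of_small (fun n hn => ?_) (fun n h4 hn => ?_) n hn
  · interval_cases n
    · exact exists_order3
    · exact exists_order9
    · exact exists_order15
    · exact exists_order21
  · interval_cases n
    · exact existsRigid_of_check (.inr rfl) checkRigidSystem_blocks27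
    · exact existsRigid_of_check (.inr rfl) checkRigidSystem_blocks33
    · exact existsRigid_of_check (.inr rfl) checkRigidSystem_blocks39
    · exact existsRigid_of_check (.inr rfl) checkRigidSystem_blocks45
    · exact existsRigid_of_checkFromSub (.inr rfl) checkRigidSystem_blocks25
        checkRigidSystemFromSub_blocks51
    · exact existsRigid_of_checkFromSub (.inr rfl) checkRigidSystem_blocks25
        checkRigidSystemFromSub_blocks57
    · exact existsRigid_of_checkFromSub (.inr rfl) checkRigidSystem_blocks25
        checkRigidSystemFromSub_blocks63
    · exact existsRigid_of_checkFromSub (.inr rfl) checkRigidSystem_blocks25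
        checkRigidSystemFromSub_blocks69

end ColoredSteiner

/-! ### Existence for all admissible orders, and the theorem. -/

open ColoredSteiner SteinerTripleSystem in
theorem exists_isUniquelyColorable {v : ℕ} (hv : 25 ≤ v) (hadm : v % 6 = 1 ∨ v % 6 = 3) :
    ∃ D : SteinerTripleSystem (Fin v), D.IsUniquelyColorable 3 := by
  rcases hadm with h | h
  · exact (existsRigid_one (v / 6) (by omega)).exists_isUniquelyColorable (by omega) (by omega)
  · exact (existsRigid_three (v / 6) (by omega)).exists_isUniquelyColorable (by omega) (by omega)

theorem proposition1 (v : ℕ) (hv : 25 ≤ v) (hadm : v % 6 = 1 ∨ v % 6 = 3) :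
    -- `d(v, 3) = 2`
    IsLeast (SteinerTripleSystem.definingNumbers v 3) 2 ∧
    -- some STS(v) is uniquely 3-colorable
    (∃ D : SteinerTripleSystem (Fin v), D.IsUniquelyColorable 3) ∧
    -- in any such system, one point from each of two color classes determines the coloring,
    -- and the defining number is 2
    (∀ D : SteinerTripleSystem (Fin v), D.IsUniquelyColorable 3 →
      (∀ φ : Fin v → Fin 3, D.IsColoring φ → ∀ x y : Fin v, φ x ≠ φ y →
        D.IsDefiningSet 3 {x, y} (fun z => φ z)) ∧
      D.IsDefiningNumber 3 2) ∧
    -- swapping the two colors not used at `x` gives another coloring with the same color at `x`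
    (∀ D : SteinerTripleSystem (Fin v), ∀ φ : Fin v → Fin 3, D.IsColoring φ →
      ∀ (x : Fin v) (a b : Fin 3), a ≠ b → a ≠ φ x → b ≠ φ x →
        D.IsColoring (Equiv.swap a b ∘ φ) ∧ (Equiv.swap a b ∘ φ) x = φ x ∧
          Equiv.swap a b ∘ φ ≠ φ) ∧
    -- hence at most one precolored point never suffices, in any STS(v)
    (∀ (D : SteinerTripleSystem (Fin v)) (S : Finset (Fin v)) (c : S → Fin 3), S.card ≤ 1 →
      ¬ D.IsDefiningSet 3 S c) := by
  have : Nontrivial (Fin v) := Fin.nontrivial_iff_two_le.2 (by omega)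
  have hex := exists_isUniquelyColorable hv hadm
  refine ⟨⟨?_, ?_⟩, hex, fun D hD => ⟨fun φ hφ x y hxy => hD.isDefiningSet hφ hxy,
    hD.isDefiningNumber⟩, fun D φ hφ x a b hab ha hb => ⟨hφ.comp (Equiv.injective _), ?_,
    hφ.swap_ne hab ha hb⟩, fun D S c hS => D.not_isDefiningSet_of_card_le_one hS⟩
  · obtain ⟨D, hD⟩ := hex
    exact ⟨D, hD.1, hD.isDefiningNumber⟩
  -- A defining number is attained by some defining set, so the bound for single sets bounds it from
  -- below.
  · rintro n ⟨D, -, ⟨S, c, hS, rfl⟩, -⟩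
    by_contra hn
    exact D.not_isDefiningSet_of_card_le_one (by omega) hS
  · exact Equiv.swap_apply_of_ne_of_ne ha.symm hb.symm
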